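/- **Setting.** Let $(X,d,\mu)$ be a metric measure space: $\mu$ is a Borel measure on the metric space $(X,d)$ with $0<\mu(B(x,r))<\infty$ for all $x\in X$, $r>0$, where $B(x,r)$ is the open ball. For measurable $E\subseteq X$, $\mathcal P(E)$ is the set of measurable $q:E\to(0,\infty]$ with $\operatorname{ess\,inf}_E q>0$; $\mathcal P_b(X)$ is the set of essentially bounded elements of $\mathcal P(X)$; and $\mathcal P_b^{\log}(X)$ is the set of $p\in\mathcal P_b(X)$ such that $f=1/p$ is log-Hölder continuous, i.e. for some $C>0$, $|f(x)-f(y)|\le C/\log(e+1/d(x,y))$ for all $x,y\in X$. We write $f\ll g$ if $\operatorname{ess\,inf}(g-f)>0$, and $f_E^-=\operatorname{ess\,inf}_E f$, $f^+=\operatorname{ess\,sup}_X f$. Put $\|f\|_{L^{p(\cdot)}(E)}=\inf\{\lambda>0:\rho_{p}(f/\lambda)\le1\}$ with $\rho_p(f)=\int_E|f|^{p(x)}d\mu$. For $g=\{g_k\}_{k\in\mathbb Z}$ put $\rho_{q,p}(g)=\sum_{k}\inf\{\lambda>0:\rho_p(g_k\lambda^{-1/q(\cdot)})\le1\}$ (with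 $\lambda^{1/\infty}=1$) and $\|g\|_{\ell^{q(\cdot)}(L^{p(\cdot)}(E))}=\inf\{\lambda>0:\rho_{q,p}(g/\lambda)\le 1\}$ (with $\inf\emptyset=\infty$). The space $\ell^{q(\cdot)}(L^{p(\cdot)}(E))$ consists of all $g$ with measurable $g_k$, $\rho_p(g_k)<\infty$ for all $k$, and $\rho_{q,p}(g/\lambda)<\infty$ for some $\lambda>0$. For a measurable, a.e. finite $u:E\to[-\infty,\infty]$, $\mathbb D^{s(\cdot)}(u)$ is the set of sequences of measurable $g_k:E\to[0,\infty]$ for which there is a null set $N$ such that for all $k\in\mathbb Z$ and all $x,y\in E\setminus N$ with $2^{-k-1}\le d(x,y)<2^{-k}$, $$|u(x)-u(y)|\le d(x,y)^{s(x)}g_k(x)+d(x,y)^{s(y)}g_k(y).$$ The Hajłasz–Besov space $\dot N^{s(\cdot)}_{p(\cdot),q(\cdot)}(E)$ consists of those $u$ with $\inf_{g\in\mathbb D^{s(\cdot)}(u)}\|g\|_{\ell^{q(\cdot)}(L^{p(\cdot)}(E))}<\infty$. **Theorem.** Let $\delta\in(0,\infty)$, $b\in(0,1]$, $\sigma\in(1,\infty)$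 and $Q\in\mathcal P_b^{\log}(X)$ be such that $\mu(B(x,r))\ge b\,r^{Q(x)}$ for all $x\in X$, $r\in(0,\delta]$. Let $p,\varepsilon\in\mathcal P_b^{\log}(X)$ and $s\in\mathcal P_b(X)$ with $\varepsilon\ll s$. Below, $B_0=B(x_0,r_0)$ with $0<r_0\le\delta/\sigma$, $\sigma B_0=B(x_0,\sigma r_0)$, $q\in\mathcal P(\sigma B_0)$, $u\in\dot N^{s(\cdot)}_{p(\cdot),q(\cdot)}(\sigma B_0)$, $g\in\mathbb D^{s(\cdot)}(u)\cap\ell^{q(\cdot)}(L^{p(\cdot)}(\sigma B_0))$ are arbitrary, $\|g\|=\|g\|_{\ell^{q(\cdot)}(L^{p(\cdot)}(\sigma B_0))}$, and $u_{B_0}$ is the average of $u$ over $B_0$. The constants $C_S,C_{MT1},C_{MT2},C_H>0$ depend only on $b,\delta,\sigma,p,\varepsilon,s,Q$; more precisely, they depend only on $b,\delta,\sigma$ and a number $\Lambda>0$ such that $\Lambda^{-1}\le Q,p,\varepsilon,s\le\Lambda$ a.e., $s-\varepsilon\ge\Lambda^{-1}$ a.e., the log-Hölder inequality holds for $1/Q,1/p,1/\varepsilon$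 with $C=\Lambda$, and, in (i) respectively (iii), $Q-\varepsilon p\ge\Lambda^{-1}$ respectively $\varepsilon p-Q\ge\Lambda^{-1}$ a.e. (such a $\Lambda$ always exists). They depend neither on $B_0,q,u,g$ nor otherwise on $(X,d,\mu)$. (i) If $\varepsilon p\ll Q$ and $\gamma_\varepsilon=\frac{Qp}{Q-\varepsilon p}$, then $$\inf_{c\in\mathbb R}\|u-c\|_{L^{\gamma_\varepsilon(\cdot)}(B_0)}\le C_S\Big(\frac{\mu(B_0)}{r_0^{Q(x_0)}}\Big)^{1/(\gamma_\varepsilon)^-_{B_0}}\|g\|.$$ (ii) If $\varepsilon p=Q$ and $\|g\|>0$, then $u$ is integrable on $B_0$ and $$\frac1{\mu(B_0)}\int_{B_0}\exp\Big(C_{MT1}\frac{|u(x)-u_{B_0}|}{\|g\|}\Big)d\mu(x)\le C_{MT2}.$$ (iii) If $\varepsilon p\gg Q$ and $\alpha_\varepsilon=\varepsilon-\frac Qp$, then $u$ is integrable on $B_0$ and $$\|u-u_{B_0}\|_{L^\infty(B_0)}\le C_H\,r_0^{\alpha_\varepsilon(x_0)}\|g\|.$$ Moreover, $u$ has a continuous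 representative $\tilde u$ on $B_0$ such that, for all $x,y\in B_0$, $$|\tilde u(x)-\tilde u(y)|\le D_H(r_0)\,\|g\|\,d(x,y)^{\alpha_\varepsilon(x)},\qquad D_H(r_0)=2^{\alpha_\varepsilon^++1}C_H\Big(\frac{\sigma\delta}{(\sigma-1)r_0}\Big)^{\alpha_\varepsilon^+}.$$ -/

import Mathlib

open MeasureTheory
open scoped ENNReal

universe w

namespace HajlaszBesov

noncomputable section

/-! ### Metric measure spaces and exponents -/

section Exponents

variable {X : Type*} [MetricSpace X] [MeasurableSpace X]

/-- All balls of positive radius have positive and finite measure. -/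
def IsMetricMeasure (μ : Measure X) : Prop :=
  ∀ (x : X) (r : ℝ), 0 < r → 0 < μ (Metric.ball x r) ∧ μ (Metric.ball x r) < ∞

/-- `μ (B(x, r)) ≥ b r ^ Q(x)` for all `x` and all `r ∈ (0, δ]`. -/
def LowerRegular (μ : Measure X) (b δ : ℝ) (Q : X → ℝ) : Prop :=
  ∀ (x : X) (r : ℝ), 0 < r → r ≤ δ → ENNReal.ofReal (b * r ^ Q x) ≤ μ (Metric.ball x r)

/-- The class `𝒫(E)` of variable exponents `q : E → (0, ∞]` on a measurable set `E`
(only the values on `E` matter). -/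
structure IsExponentOn (μ : Measure X) (E : Set X) (q : X → ℝ≥0∞) : Prop where
  measurable : Measurable (fun x : E => q x)
  pos : ∀ x ∈ E, 0 < q x
  essInf_pos : 0 < essInf q (μ.restrict E)

/-- `m ≤ f ≤ M` almost everywhere. -/
def EssBetween (μ : Measure X) (m M : ℝ) (f : X → ℝ) : Prop :=
  ∀ᵐ x ∂μ, m ≤ f x ∧ f x ≤ M

/-- The class `𝒫_b(X)` of (essentially) bounded variable exponents. -/
structure IsBddExponent (μ : Measure X) (p : X → ℝ) : Prop where
  measurable : Measurable p
  pos : ∀ x, 0 < p x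
  bounds : ∃ m M : ℝ, 0 < m ∧ EssBetween μ m M p

/-- The log-Hölder inequality with constant `C`. -/
def LogHolderWith (C : ℝ) (f : X → ℝ) : Prop :=
  ∀ x y : X, |f x - f y| ≤ C / Real.log (Real.exp 1 + 1 / dist x y)

/-- The class `𝒫_b^log(X)`: bounded exponents `p` with `1 / p` log-Hölder continuous. -/
structure IsLogExponent (μ : Measure X) (p : X → ℝ) : Prop extends IsBddExponent μ p where
  logHolder : ∃ C : ℝ, 0 < C ∧ LogHolderWith C (fun x => 1 / p x)

/-- `g - f ≥ κ` almost everywhere. -/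
def EssGap (μ : Measure X) (κ : ℝ) (f g : X → ℝ) : Prop :=
  ∀ᵐ x ∂μ, κ ≤ g x - f x

/-- The relation `f ≪ g`: the essential infimum of `g - f` is positive. -/
def EssLT (μ : Measure X) (f g : X → ℝ) : Prop :=
  ∃ κ : ℝ, 0 < κ ∧ EssGap μ κ f g

/-- The number `Λ` controls the essential bounds of `Q, p, ε, s`, the log-Hölder constants of
`1/Q, 1/p, 1/ε` and the gap between `ε` and `s`.  -/
structure ControlledBy (Λ : ℝ) (μ : Measure X) (Q p ε s : X → ℝ) : Prop where
  bounds_Q : EssBetween μ Λ⁻¹ Λ Q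
  bounds_p : EssBetween μ Λ⁻¹ Λ p
  bounds_ε : EssBetween μ Λ⁻¹ Λ ε
  bounds_s : EssBetween μ Λ⁻¹ Λ s
  log_Q : LogHolderWith Λ (fun x => 1 / Q x)
  log_p : LogHolderWith Λ (fun x => 1 / p x)
  log_ε : LogHolderWith Λ (fun x => 1 / ε x)
  gap : EssGap μ Λ⁻¹ ε s

theorem log_pos_aux (t : ℝ) (ht : 0 ≤ t) : 0 < Real.log (Real.exp 1 + 1 / t) := by
  apply Real.log_pos
  have h1 : (1 : ℝ) < Real.exp 1 := by simp
  have h2 : 0 ≤ 1 / t := by positivity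
  linarith

theorem LogHolderWith.mono {C D : ℝ} (h : C ≤ D) {f : X → ℝ} (hf : LogHolderWith C f) :
    LogHolderWith D f := fun x y =>
  (hf x y).trans (div_le_div_of_nonneg_right h (log_pos_aux _ dist_nonneg).le)

theorem IsBddExponent.exists_bound {μ : Measure X} {p : X → ℝ} (hp : IsBddExponent μ p) :
    ∃ L : ℝ, 0 < L ∧ ∀ Λ, L ≤ Λ → EssBetween μ Λ⁻¹ Λ p := by
  obtain ⟨m, M, hm, h⟩ := hp.bounds
  refine ⟨max m⁻¹ M, lt_max_of_lt_left (inv_pos.2 hm), fun Λ hΛ => ?_⟩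
  filter_upwards [h] with x hx
  exact ⟨(inv_le_of_inv_le₀ hm ((le_max_left _ _).trans hΛ)).trans hx.1,
    hx.2.trans ((le_max_right _ _).trans hΛ)⟩

/-- Every admissible quadruple of exponents is controlled by all sufficiently large `Λ`. -/
theorem exists_controlledBy {μ : Measure X} {Q p ε s : X → ℝ} (hQ : IsLogExponent μ Q)
    (hp : IsLogExponent μ p) (hε : IsLogExponent μ ε) (hs : IsBddExponent μ s)
    (hεs : EssLT μ ε s) : ∃ L : ℝ, 0 < L ∧ ∀ Λ, L ≤ Λ → ControlledBy Λ μ Q p ε s := by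
  obtain ⟨a₁, ha₁, h₁⟩ := hQ.toIsBddExponent.exists_bound
  obtain ⟨a₂, _, h₂⟩ := hp.toIsBddExponent.exists_bound
  obtain ⟨a₃, _, h₃⟩ := hε.toIsBddExponent.exists_bound
  obtain ⟨a₄, _, h₄⟩ := hs.exists_bound
  obtain ⟨c₁, _, k₁⟩ := hQ.logHolder
  obtain ⟨c₂, _, k₂⟩ := hp.logHolder
  obtain ⟨c₃, _, k₃⟩ := hε.logHolder
  obtain ⟨κ, hκ, hg⟩ := hεs
  refine ⟨max a₁ (max a₂ (max a₃ (max a₄ (max c₁ (max c₂ (max c₃ κ⁻¹)))))),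
    lt_max_of_lt_left ha₁, fun Λ hΛ => ?_⟩
  simp only [max_le_iff] at hΛ
  obtain ⟨e₁, e₂, e₃, e₄, e₅, e₆, e₇, e₈⟩ := hΛ
  refine ⟨h₁ _ e₁, h₂ _ e₂, h₃ _ e₃, h₄ _ e₄, k₁.mono e₅, k₂.mono e₆, k₃.mono e₇, ?_⟩
  filter_upwards [hg] with x hx
  exact (inv_le_of_inv_le₀ hκ e₈).trans hx

/-- The standing hypotheses on the metric measure space and on the exponents, in the quantitative
form with control parameter `Λ`. -/
structure Setting (b δ Λ : ℝ) (μ : Measure X) (Q p ε s : X → ℝ) : Prop where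
  metricMeasure : IsMetricMeasure μ
  lowerRegular : LowerRegular μ b δ Q
  Q_mem : IsLogExponent μ Q
  p_mem : IsLogExponent μ p
  ε_mem : IsLogExponent μ ε
  s_mem : IsBddExponent μ s
  ε_lt_s : EssLT μ ε s
  controlled : ControlledBy Λ μ Q p ε s

end Exponents

/-! ### Function spaces on a measurable set `E`

Functions on `E` are represented by functions on `X` of which only the values on `E` matter. Since
only absolute values enter the modulars, these are defined for functions with values in
`[0, ∞]`. -/

section Spaces

variable {X : Type*} [MetricSpace X] [MeasurableSpace X]

/-- The semi-modular `∫_E |f|^{p(x)} dμ` of `L^{p(·)}(E)`. -/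
def modular (μ : Measure X) (E : Set X) (p : X → ℝ) (f : X → ℝ≥0∞) : ℝ≥0∞ :=
  ∫⁻ x in E, f x ^ p x ∂μ

/-- The Luxemburg quasi-norm of `L^{p(·)}(E)` (infinite if there is no admissible `l`). -/
def luxNorm (μ : Measure X) (E : Set X) (p : X → ℝ) (f : X → ℝ≥0∞) : ℝ≥0∞ :=
  ⨅ (l : ℝ) (_ : 0 < l) (_ : modular μ E p (fun x => f x / ENNReal.ofReal l) ≤ 1),
    ENNReal.ofReal l

/-- The semi-modular of `ℓ^{q(·)}(L^{p(·)}(E))`; the convention `l ^ (1/∞) = 1` is built in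
because `∞⁻¹ = 0`. -/
def mixedModular (μ : Measure X) (E : Set X) (p : X → ℝ) (q : X → ℝ≥0∞) (g : ℤ → X → ℝ≥0∞) :
    ℝ≥0∞ :=
  ∑' k : ℤ, ⨅ (l : ℝ) (_ : 0 < l)
    (_ : modular μ E p (fun x => g k x / ENNReal.ofReal (l ^ ((q x)⁻¹).toReal)) ≤ 1),
    ENNReal.ofReal l

/-- The quasi-norm of `ℓ^{q(·)}(L^{p(·)}(E))`. -/
def mixedNorm (μ : Measure X) (E : Set X) (p : X → ℝ) (q : X → ℝ≥0∞) (g : ℤ → X → ℝ≥0∞) :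
    ℝ≥0∞ :=
  ⨅ (l : ℝ) (_ : 0 < l)
    (_ : mixedModular μ E p q (fun k x => g k x / ENNReal.ofReal l) ≤ 1), ENNReal.ofReal l

/-- Membership in `ℓ^{q(·)}(L^{p(·)}(E))`. -/
structure MemMixed (μ : Measure X) (E : Set X) (p : X → ℝ) (q : X → ℝ≥0∞)
    (g : ℤ → X → ℝ≥0∞) : Prop where
  measurable : ∀ k, Measurable (fun x : E => g k x)
  memLp : ∀ k, modular μ E p (g k) < ∞
  finite : ∃ l : ℝ, 0 < l ∧ mixedModular μ E p q (fun k x => g k x / ENNReal.ofReal l) < ∞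

/-- `g ∈ 𝔻^{s(·)}(u)`: the sequence `g` is a vector `s(·)`-gradient of `u` on `E`. -/
structure IsVectorGradient (μ : Measure X) (E : Set X) (s : X → ℝ) (u : X → EReal)
    (g : ℤ → X → ℝ≥0∞) : Prop where
  measurable : ∀ k, Measurable (fun x : E => g k x)
  ineq : ∃ N : Set X, μ N = 0 ∧ ∀ k : ℤ, ∀ x ∈ E \ N, ∀ y ∈ E \ N,
    (2 : ℝ) ^ (-k - 1) ≤ dist x y → dist x y < (2 : ℝ) ^ (-k) →
      (u x - u y).abs ≤
        ENNReal.ofReal (dist x y ^ s x) * g k x + ENNReal.ofReal (dist x y ^ s y) * g k y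

/-- The quasi-semi-norm of the homogeneous Hajłasz–Besov space on `E`. -/
def besovNorm (μ : Measure X) (E : Set X) (s p : X → ℝ) (q : X → ℝ≥0∞) (u : X → EReal) : ℝ≥0∞ :=
  ⨅ (g : ℤ → X → ℝ≥0∞) (_ : IsVectorGradient μ E s u g), mixedNorm μ E p q g

/-- Membership in the homogeneous Hajłasz–Besov space on `E`. -/
structure MemBesov (μ : Measure X) (E : Set X) (s p : X → ℝ) (q : X → ℝ≥0∞)
    (u : X → EReal) : Prop where
  measurable : Measurable (fun x : E => u x)
  ae_finite : ∀ᵐ x ∂μ.restrict E, u x ≠ ⊤ ∧ u x ≠ ⊥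
  norm_lt_top : besovNorm μ E s p q u < ∞

/-- The function `|u - c|`, with values in `[0, ∞]`. -/
def absSub (u : X → EReal) (c : ℝ) (x : X) : ℝ≥0∞ := (u x - (c : EReal)).abs

/-- The integral average of the (almost everywhere finite) function `u` over `E`. -/
def avg (μ : Measure X) (E : Set X) (u : X → EReal) : ℝ := ⨍ x in E, (u x).toReal ∂μ

/-- The Sobolev exponent `γ_ε = Qp / (Q - εp)`. -/
def sobolevExp (Q p ε : X → ℝ) (x : X) : ℝ := Q x * p x / (Q x - ε x * p x)

/-- The Hölder exponent `α_ε = ε - Q / p`. -/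
def holderExp (Q p ε : X → ℝ) (x : X) : ℝ := ε x - Q x / p x

/-- A ball `B(x₀, r₀)` with `0 < r₀ ≤ δ / σ`, an exponent `q ∈ 𝒫(σB₀)`, a function `u` in the
homogeneous Hajłasz–Besov space on `σB₀` and a vector gradient `g` of `u` in
`ℓ^{q(·)}(L^{p(·)}(σB₀))`. -/
structure LocalData (δ σ : ℝ) (μ : Measure X) (p s : X → ℝ) (x₀ : X) (r₀ : ℝ) (q : X → ℝ≥0∞)
    (u : X → EReal) (g : ℤ → X → ℝ≥0∞) : Prop where
  radius_pos : 0 < r₀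
  radius_le : r₀ ≤ δ / σ
  q_mem : IsExponentOn μ (Metric.ball x₀ (σ * r₀)) q
  u_mem : MemBesov μ (Metric.ball x₀ (σ * r₀)) s p q u
  g_grad : IsVectorGradient μ (Metric.ball x₀ (σ * r₀)) s u g
  g_mem : MemMixed μ (Metric.ball x₀ (σ * r₀)) p q g

end Spaces

end

end HajlaszBesov

/-!
After dividing by `‖g‖` one may assume that the modular of the vector gradient `g` is at most one.
Since `ε ≪ s`, multiplying `g k` by the decaying weight `2 ^ (-k (s - ε))` and summing over the
dyadic scales below the size of the ball replaces the whole sequence by a single function `H` with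
`|u x - u y| ≤ d(x, y) ^ ε(x) H x + d(x, y) ^ ε(y) H y` and with `∫ H ^ p` bounded, irrespective
of `q`.

By Chebyshev's inequality and `b r ^ Q ≤ μ(B(x, r))`, every ball of radius `r` contains a point
where `H ≲ r ^ (-Q / p)`.  Chaining such points through shrinking dyadic balls around `x`, down to
the scale at which `x` is itself a good point, bounds the oscillation of `u` by a geometric sum of
the terms `r ^ (ε - Q / p)`; log-Hölder continuity freezes the exponents on each ball.  When
`ε p < Q` the smallest radius dominates and the sum is controlled by a power of `H x`, when
`ε p = Q` all terms are comparable and the number of steps is logarithmic in `H x`, and when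
`ε p > Q` the largest radius dominates and the sum does not see `H x` at all.
-/

namespace HajlaszBesov

section LogHolder

variable {X : Type*} [MetricSpace X] {f g : X → ℝ} {L M A B : ℝ}

theorem one_le_log_exp_one_add_one_div {t : ℝ} (ht : 0 ≤ t) :
    1 ≤ Real.log (Real.exp 1 + 1 / t) := by
  have h : 0 ≤ 1 / t := one_div_nonneg.2 ht
  rw [Real.le_log_iff_exp_le (by positivity)]
  linarith

theorem LogHolderWith.nonneg (hf : LogHolderWith L f) (x : X) : 0 ≤ L := by
  have h := (abs_nonneg _).trans (hf x x)
  rwa [le_div_iff₀ (log_pos_aux _ dist_nonneg), zero_mul] at h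

theorem LogHolderWith.of_le (hf : LogHolderWith L f) (h : L ≤ M) : LogHolderWith M f :=
  letI := borel X
  hf.mono h

theorem LogHolderWith.neg (hf : LogHolderWith L f) : LogHolderWith L (fun x => -f x) :=
  fun x y => by
    rw [neg_sub_neg, abs_sub_comm]
    exact hf x y

theorem LogHolderWith.sub (hf : LogHolderWith L f) (hg : LogHolderWith M g) :
    LogHolderWith (L + M) (fun x => f x - g x) := fun x y => by
  rw [sub_sub_sub_comm, add_div]
  exact (abs_sub _ _).trans (add_le_add (hf x y) (hg x y))

theorem LogHolderWith.mul (hf : LogHolderWith L f) (hg : LogHolderWith M g) (hA : ∀ x, |f x| ≤ A)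
    (hB : ∀ x, |g x| ≤ B) : LogHolderWith (A * M + B * L) (fun x => f x * g x) := fun x y => by
  have hA0 : 0 ≤ A := (abs_nonneg _).trans (hA x)
  have hB0 : 0 ≤ B := (abs_nonneg _).trans (hB x)
  calc |f x * g x - f y * g y| = |f x * (g x - g y) + g y * (f x - f y)| := by ring_nf
    _ ≤ |f x| * |g x - g y| + |g y| * |f x - f y| := by
        simpa only [abs_mul] using abs_add_le (f x * (g x - g y)) (g y * (f x - f y))
    _ ≤ A * (M / Real.log (Real.exp 1 + 1 / dist x y)) +
          B * (L / Real.log (Real.exp 1 + 1 / dist x y)) := by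
        gcongr
        exacts [hA x, hg x y, hB y, hf x y]
    _ = _ := by ring

theorem LogHolderWith.of_one_div (hf : LogHolderWith L (fun x => 1 / f x)) (hpos : ∀ x, 0 < f x)
    (hA : ∀ x, f x ≤ A) : LogHolderWith (A ^ 2 * L) f := fun x y => by
  have hne : ∀ z, f z ≠ 0 := fun z => (hpos z).ne'
  have hfA : f x * f y ≤ A ^ 2 := by
    rw [pow_two]
    exact mul_le_mul (hA x) (hA y) (hpos y).le ((hpos x).le.trans (hA x))
  have hdiff : f y - f x = f x * f y * (1 / f x - 1 / f y) := by field_simp [hne x, hne y]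
  calc |f x - f y| = f x * f y * |1 / f x - 1 / f y| := by
        rw [abs_sub_comm, hdiff, abs_mul, abs_of_pos (mul_pos (hpos x) (hpos y))]
    _ ≤ A ^ 2 * (L / Real.log (Real.exp 1 + 1 / dist x y)) :=
        mul_le_mul hfA (hf x y) (abs_nonneg _) (sq_nonneg A)
    _ = _ := by ring

theorem LogHolderWith.continuous (hf : LogHolderWith L f) : Continuous f := by
  rw [continuous_iff_continuousAt]
  intro x
  rw [continuousAt_iff_punctured_nhds, tendsto_iff_dist_tendsto_zero]
  have hdist : Filter.Tendsto (fun y => dist y x) (nhdsWithin x {x}ᶜ) (nhdsWithin 0 (Set.Ioi 0)) :=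
    tendsto_nhdsWithin_iff.2 ⟨(tendsto_iff_dist_tendsto_zero.1 Filter.tendsto_id).mono_left
      nhdsWithin_le_nhds, by filter_upwards [self_mem_nhdsWithin] with y hy using dist_pos.2 hy⟩
  have hmodulus : Filter.Tendsto (fun y => L / Real.log (Real.exp 1 + 1 / dist y x))
      (nhdsWithin x {x}ᶜ) (nhds 0) := by
    simp only [one_div]
    exact (Real.tendsto_log_atTop.comp (Filter.tendsto_atTop_add_const_left _ _
      hdist.inv_tendsto_nhdsGT_zero)).const_div_atTop L
  exact squeeze_zero (fun _ => dist_nonneg) (fun y => by rw [Real.dist_eq]; exact hf y x) hmodulus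

theorem LogHolderWith.continuous_of_one_div (hf : LogHolderWith L (fun x => 1 / f x))
    (hpos : ∀ x, 0 < f x) : Continuous f :=
  (hf.continuous.inv₀ fun x => (one_div_pos.2 (hpos x)).ne').congr fun x => by
    rw [Pi.inv_apply, one_div, inv_inv]

theorem abs_log_le_mul_log_exp_one_add_one_div {K R δ t : ℝ} (hK : 1 ≤ K) (hR : 0 < R)
    (hRδ : R ≤ δ) (ht : 0 < t) (htR : t ≤ K * R) :
    |Real.log R| ≤ (Real.log K + 1 + |Real.log δ|) * Real.log (Real.exp 1 + 1 / t) := by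
  have hT := one_le_log_exp_one_add_one_div ht.le
  set T := Real.log (Real.exp 1 + 1 / t)
  have hlogK := Real.log_nonneg hK
  have hlogδ := abs_nonneg (Real.log δ)
  have hlower : -Real.log R ≤ Real.log K + T := by
    have hinv : R⁻¹ ≤ K * (Real.exp 1 + 1 / t) := by
      have h : R⁻¹ ≤ K * (1 / t) := by
        rw [mul_one_div, inv_eq_one_div, div_le_div_iff₀ hR ht]
        linarith
      nlinarith [Real.exp_pos 1]
    have h := Real.log_le_log (by positivity) hinv
    rwa [Real.log_mul (by positivity) (by positivity), Real.log_inv] at h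
  have hupper : Real.log R ≤ |Real.log δ| := (Real.log_le_log hR hRδ).trans (le_abs_self _)
  have hsum : |Real.log R| ≤ Real.log K + T + |Real.log δ| :=
    abs_le.2 ⟨by linarith, by linarith⟩
  nlinarith

theorem LogHolderWith.abs_sub_mul_abs_log_le (hf : LogHolderWith L f) {K R δ : ℝ} (hK : 1 ≤ K)
    (hR : 0 < R) (hRδ : R ≤ δ) {x y : X} (hxy : dist x y ≤ K * R) :
    |f x - f y| * |Real.log R| ≤ L * (Real.log K + 1 + |Real.log δ|) := by
  have hL := hf.nonneg x
  have hlogK := Real.log_nonneg hK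
  rcases eq_or_ne x y with rfl | hne
  · rw [sub_self, abs_zero, zero_mul]
    positivity
  have hT := log_pos_aux (dist x y) dist_nonneg
  calc |f x - f y| * |Real.log R|
      ≤ L / Real.log (Real.exp 1 + 1 / dist x y) * ((Real.log K + 1 + |Real.log δ|) *
          Real.log (Real.exp 1 + 1 / dist x y)) :=
        mul_le_mul (hf x y)
          (abs_log_le_mul_log_exp_one_add_one_div hK hR hRδ (dist_pos.2 hne) hxy)
          (abs_nonneg _) (by positivity)
    _ = L * (Real.log K + 1 + |Real.log δ|) := by field_simp

theorem LogHolderWith.rpow_le_mul_rpow (hf : LogHolderWith L f) {K R δ : ℝ} (hK : 1 ≤ K)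
    (hR : 0 < R) (hRδ : R ≤ δ) {x y : X} (hxy : dist x y ≤ K * R) :
    R ^ f x ≤ Real.exp (L * (Real.log K + 1 + |Real.log δ|)) * R ^ f y := by
  rw [Real.rpow_def_of_pos hR, Real.rpow_def_of_pos hR, ← Real.exp_add, Real.exp_le_exp]
  have h := hf.abs_sub_mul_abs_log_le hK hR hRδ hxy
  rw [← abs_mul] at h
  linarith [le_abs_self ((f x - f y) * Real.log R)]

end LogHolder

/-- The factor relating `R ^ f x` and `R ^ f y` for `R ≤ δ` and `dist x y ≤ K * R`, where `f` is
any of the exponents `Q`, `ε`, `Q / p`, `ε - Q / p` or their negatives; all of them are log-Hölder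
continuous with constant `3 * Λ ^ 4`. -/
noncomputable def rpowConst (Λ δ K : ℝ) : ℝ :=
  Real.exp (3 * Λ ^ 4 * (Real.log K + 1 + |Real.log δ|))

theorem rpowConst_pos (Λ δ K : ℝ) : 0 < rpowConst Λ δ K := Real.exp_pos _

theorem one_le_rpowConst {Λ δ K : ℝ} (hK : 1 ≤ K) : 1 ≤ rpowConst Λ δ K := by
  have := Real.log_nonneg hK
  exact Real.one_le_exp (by positivity)

/-- Exponents satisfying the bounds of `ControlledBy` at every point, not just almost everywhere. -/
structure RegularExponents {X : Type*} [MetricSpace X] (Λ : ℝ) (Q p ε : X → ℝ) : Prop where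
  one_le : 1 ≤ Λ
  le_Q : ∀ x, Λ⁻¹ ≤ Q x
  Q_le : ∀ x, Q x ≤ Λ
  le_p : ∀ x, Λ⁻¹ ≤ p x
  p_le : ∀ x, p x ≤ Λ
  le_ε : ∀ x, Λ⁻¹ ≤ ε x
  ε_le : ∀ x, ε x ≤ Λ
  log_Q : LogHolderWith Λ (fun x => 1 / Q x)
  log_p : LogHolderWith Λ (fun x => 1 / p x)
  log_ε : LogHolderWith Λ (fun x => 1 / ε x)

namespace RegularExponents

variable {X : Type*} [MetricSpace X] {Λ : ℝ} {Q p ε : X → ℝ}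

theorem pos (h : RegularExponents Λ Q p ε) : 0 < Λ := zero_lt_one.trans_le h.one_le

theorem Q_pos (h : RegularExponents Λ Q p ε) (x : X) : 0 < Q x :=
  (inv_pos.2 h.pos).trans_le (h.le_Q x)

theorem p_pos (h : RegularExponents Λ Q p ε) (x : X) : 0 < p x :=
  (inv_pos.2 h.pos).trans_le (h.le_p x)

theorem ε_pos (h : RegularExponents Λ Q p ε) (x : X) : 0 < ε x :=
  (inv_pos.2 h.pos).trans_le (h.le_ε x)

theorem abs_Q_le (h : RegularExponents Λ Q p ε) (x : X) : |Q x| ≤ Λ := by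
  rw [abs_of_pos (h.Q_pos x)]
  exact h.Q_le x

theorem one_div_p_le (h : RegularExponents Λ Q p ε) (x : X) : 1 / p x ≤ Λ := by
  rw [one_div]
  exact inv_le_of_inv_le₀ h.pos (h.le_p x)

theorem abs_one_div_p_le (h : RegularExponents Λ Q p ε) (x : X) : |1 / p x| ≤ Λ := by
  rw [abs_of_pos (one_div_pos.2 (h.p_pos x))]
  exact h.one_div_p_le x

theorem Q_div_p_pos (h : RegularExponents Λ Q p ε) (x : X) : 0 < Q x / p x :=
  div_pos (h.Q_pos x) (h.p_pos x)

theorem Q_div_p_le (h : RegularExponents Λ Q p ε) (x : X) : Q x / p x ≤ Λ ^ 2 := by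
  rw [div_eq_mul_one_div, pow_two]
  exact mul_le_mul (h.Q_le x) (h.one_div_p_le x) (one_div_pos.2 (h.p_pos x)).le h.pos.le

theorem abs_holderExp_le (h : RegularExponents Λ Q p ε) (x : X) : |holderExp Q p ε x| ≤ Λ ^ 2 := by
  have hεΛ : ε x ≤ Λ ^ 2 := (h.ε_le x).trans (le_self_pow₀ h.one_le two_ne_zero)
  have hQp := h.Q_div_p_le x
  have hQp0 := h.Q_div_p_pos x
  have hε0 := h.ε_pos x
  rw [holderExp, abs_le]
  constructor <;> linarith

theorem logHolder_Q (h : RegularExponents Λ Q p ε) : LogHolderWith (3 * Λ ^ 4) Q :=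
  (h.log_Q.of_one_div h.Q_pos h.Q_le).of_le (by
    have h34 : Λ ^ 3 ≤ Λ ^ 4 := pow_le_pow_right₀ h.one_le (by norm_num)
    have h3 : 0 < Λ ^ 3 := pow_pos h.pos 3
    linarith [pow_succ Λ 2])

theorem logHolder_ε (h : RegularExponents Λ Q p ε) : LogHolderWith (3 * Λ ^ 4) ε :=
  (h.log_ε.of_one_div h.ε_pos h.ε_le).of_le (by
    have h34 : Λ ^ 3 ≤ Λ ^ 4 := pow_le_pow_right₀ h.one_le (by norm_num)
    have h3 : 0 < Λ ^ 3 := pow_pos h.pos 3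
    linarith [pow_succ Λ 2])

theorem logHolder_const_div_p (h : RegularExponents Λ Q p ε) {c : ℝ} (hc : |c| ≤ Λ) :
    LogHolderWith (3 * Λ ^ 4) (fun x => c / p x) := by
  have hconst : LogHolderWith 0 (fun _ : X => c) := fun x y => by simp
  have h24 : Λ ^ 2 ≤ Λ ^ 4 := pow_le_pow_right₀ h.one_le (by norm_num)
  simpa only [div_eq_mul_one_div c] using
    (hconst.mul h.log_p (fun _ => hc) h.abs_one_div_p_le).of_le (by nlinarith [sq_nonneg Λ])

theorem logHolder_Q_div_p (h : RegularExponents Λ Q p ε) :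
    LogHolderWith (2 * Λ ^ 4) (fun x => Q x / p x) := by
  have h24 : Λ ^ 2 ≤ Λ ^ 4 := pow_le_pow_right₀ h.one_le (by norm_num)
  simpa only [← div_eq_mul_one_div] using
    ((h.log_Q.of_one_div h.Q_pos h.Q_le).mul h.log_p h.abs_Q_le h.abs_one_div_p_le).of_le
      (by nlinarith)

theorem logHolder_holderExp (h : RegularExponents Λ Q p ε) :
    LogHolderWith (3 * Λ ^ 4) (holderExp Q p ε) :=
  ((h.log_ε.of_one_div h.ε_pos h.ε_le).sub h.logHolder_Q_div_p).of_le (by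
    have h34 : Λ ^ 3 ≤ Λ ^ 4 := pow_le_pow_right₀ h.one_le (by norm_num)
    linarith [pow_succ Λ 2])

theorem continuous_Q (h : RegularExponents Λ Q p ε) : Continuous Q :=
  h.log_Q.continuous_of_one_div h.Q_pos

theorem continuous_p (h : RegularExponents Λ Q p ε) : Continuous p :=
  h.log_p.continuous_of_one_div h.p_pos

theorem continuous_ε (h : RegularExponents Λ Q p ε) : Continuous ε :=
  h.log_ε.continuous_of_one_div h.ε_pos

end RegularExponents

theorem rpow_mul_rpow_eq_holderExp {X : Type*} (Q p ε : X → ℝ) {R : ℝ} (hR : 0 < R) (x : X) :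
    R ^ ε x * R ^ (-(Q x / p x)) = R ^ holderExp Q p ε x := by
  rw [← Real.rpow_add hR, ← sub_eq_add_neg, holderExp]

theorem rpow_le_max_inv_rpow {a t M : ℝ} (ha : 0 < a) (ht : |t| ≤ M) :
    a ^ t ≤ (max a a⁻¹) ^ M := by
  have hmax : 1 ≤ max a a⁻¹ := by
    rcases le_total 1 a with h | h
    · exact le_max_of_le_left h
    · exact le_max_of_le_right ((one_le_inv₀ ha).2 h)
  have habs : a ^ t ≤ (max a a⁻¹) ^ |t| := by
    rcases abs_cases t with ⟨h, ht0⟩ | ⟨h, ht0⟩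
    · rw [h]
      exact Real.rpow_le_rpow ha.le (le_max_left _ _) ht0
    · rw [h, ← neg_neg t, Real.rpow_neg ha.le, ← Real.inv_rpow ha.le, neg_neg]
      exact Real.rpow_le_rpow (inv_pos.2 ha).le (le_max_right _ _) (by linarith)
  exact habs.trans (Real.rpow_le_rpow_of_exponent_le hmax ht)

/-- A function `U` with Hajłasz gradient `H` of variable order `ε` on `S`, where `S` meets every
ball `B(x, R) ⊆ E` with `R ≤ δ` in a point at which `H ^ p ≤ A * R ^ (-Q x)`. -/
structure HajlaszPair {X : Type*} [MetricSpace X] (δ A : ℝ) (Q p ε : X → ℝ) (E S : Set X)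
    (U H : X → ℝ) : Prop where
  nonneg : ∀ x, 0 ≤ H x
  hajlasz_le : ∀ x ∈ S, ∀ y ∈ S, |U x - U y| ≤ dist x y ^ ε x * H x + dist x y ^ ε y * H y
  exists_rpow_le : ∀ (x : X) (R : ℝ), 0 < R → R ≤ δ → Metric.ball x R ⊆ E →
    ∃ z ∈ S, dist z x < R ∧ H z ^ p z ≤ A * R ^ (-Q x)

/-- The factor `G` for which every ball `B(x, R)` contains a point `z` with
`H z ≤ G * R ^ (-(Q x / p x))`. -/
noncomputable def goodConst (Λ δ A : ℝ) : ℝ := A ^ Λ * rpowConst Λ δ 1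

/-- The constant in the oscillation bound for two points within distance `K * R` of each other at
which the gradient is at most `G * R ^ (-(Q / p))`. -/
noncomputable def stepConst (Λ δ K G : ℝ) : ℝ := 2 * (K ^ Λ * rpowConst Λ δ K ^ 2 * G)

/-- The constant in the chain bound along dyadic balls centred at one point. -/
noncomputable def chainConst (Λ δ A : ℝ) : ℝ := stepConst Λ δ 2 (2 ^ Λ ^ 2 * goodConst Λ δ A)

/-- The constant in the chain bound from the points of `B(x₀, r₀)` to a common reference point. -/
noncomputable def ballChainConst (Λ δ A σ : ℝ) : ℝ :=
  chainConst Λ δ A + stepConst Λ δ (2 + 1 / (σ - 1)) (goodConst Λ δ A)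

theorem goodConst_pos {Λ δ A : ℝ} (hA : 0 < A) : 0 < goodConst Λ δ A :=
  mul_pos (Real.rpow_pos_of_pos hA Λ) (rpowConst_pos Λ δ 1)

theorem one_le_goodConst {Λ δ A : ℝ} (hΛ : 0 ≤ Λ) (hA : 1 ≤ A) : 1 ≤ goodConst Λ δ A :=
  one_le_mul_of_one_le_of_one_le (Real.one_le_rpow hA hΛ) (one_le_rpowConst le_rfl)

theorem stepConst_pos {Λ δ K G : ℝ} (hK : 0 < K) (hG : 0 < G) : 0 < stepConst Λ δ K G := by
  have := rpowConst_pos Λ δ K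
  unfold stepConst
  positivity

theorem one_le_stepConst {Λ δ K G : ℝ} (hΛ : 0 ≤ Λ) (hK : 1 ≤ K) (hG : 1 ≤ G) :
    1 ≤ stepConst Λ δ K G := by
  have hpow : 1 ≤ K ^ Λ * rpowConst Λ δ K ^ 2 :=
    one_le_mul_of_one_le_of_one_le (Real.one_le_rpow hK hΛ) (one_le_pow₀ (one_le_rpowConst hK))
  have := one_le_mul_of_one_le_of_one_le hpow hG
  unfold stepConst
  linarith

theorem one_le_chainConst {Λ δ A : ℝ} (hΛ : 0 ≤ Λ) (hA : 1 ≤ A) : 1 ≤ chainConst Λ δ A :=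
  one_le_stepConst hΛ one_le_two (one_le_mul_of_one_le_of_one_le
    (Real.one_le_rpow one_le_two (sq_nonneg Λ)) (one_le_goodConst hΛ hA))

section Chaining

variable {X : Type*} [MetricSpace X] {Λ δ A σ K G R r₀ : ℝ} {Q p ε : X → ℝ} {E S : Set X}
  {U H : X → ℝ} {x x₀ : X}

theorem RegularExponents.rpow_mul_le (h : RegularExponents Λ Q p ε) (hK : 1 ≤ K) (hG : 0 ≤ G)
    (hR : 0 < R) (hRδ : R ≤ δ) {v y : X} {a d : ℝ} (hv : dist v x ≤ K * R) (hy : dist y x ≤ K * R)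
    (hd₀ : 0 ≤ d) (hd : d ≤ K * R) (ha : a ≤ G * R ^ (-(Q y / p y))) :
    d ^ ε v * a ≤ K ^ Λ * rpowConst Λ δ K ^ 2 * G * R ^ holderExp Q p ε x := by
  have hC := rpowConst_pos Λ δ K
  have hdε : d ^ ε v ≤ K ^ Λ * (rpowConst Λ δ K * R ^ ε x) := calc
    d ^ ε v ≤ (K * R) ^ ε v := Real.rpow_le_rpow hd₀ hd (h.ε_pos v).le
    _ = K ^ ε v * R ^ ε v := Real.mul_rpow (by linarith) hR.le
    _ ≤ _ := by
      gcongr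
      · exact h.ε_le v
      · exact h.logHolder_ε.rpow_le_mul_rpow hK hR hRδ hv
  have hbase : R ^ (-(Q y / p y)) ≤ rpowConst Λ δ K * R ^ (-(Q x / p x)) :=
    (h.logHolder_Q_div_p.neg.of_le (by linarith [pow_pos h.pos 4])).rpow_le_mul_rpow hK hR hRδ hy
  calc d ^ ε v * a
      ≤ K ^ Λ * (rpowConst Λ δ K * R ^ ε x) * (G * (rpowConst Λ δ K * R ^ (-(Q x / p x)))) := by
        exact (mul_le_mul_of_nonneg_left (ha.trans (mul_le_mul_of_nonneg_left hbase hG))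
          (Real.rpow_nonneg hd₀ _)).trans (mul_le_mul_of_nonneg_right hdε (by positivity))
    _ = K ^ Λ * rpowConst Λ δ K ^ 2 * G * (R ^ ε x * R ^ (-(Q x / p x))) := by ring
    _ = _ := by rw [rpow_mul_rpow_eq_holderExp Q p ε hR]

namespace HajlaszPair

theorem exists_le_goodConst_mul (hexp : RegularExponents Λ Q p ε)
    (h : HajlaszPair δ A Q p ε E S U H) (hA : 1 ≤ A) (hR : 0 < R) (hRδ : R ≤ δ)
    (hsub : Metric.ball x R ⊆ E) :
    ∃ z ∈ S, dist z x < R ∧ H z ≤ goodConst Λ δ A * R ^ (-(Q x / p x)) := by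
  obtain ⟨z, hz, hzx, hHz⟩ := h.exists_rpow_le x R hR hRδ hsub
  refine ⟨z, hz, hzx, ?_⟩
  have hcomp : R ^ (-(Q x / p z)) ≤ rpowConst Λ δ 1 * R ^ (-(Q x / p x)) :=
    (hexp.logHolder_const_div_p (hexp.abs_Q_le x)).neg.rpow_le_mul_rpow le_rfl hR hRδ
      (by linarith)
  calc H z ≤ (A * R ^ (-Q x)) ^ (1 / p z) := by
        rwa [one_div, Real.le_rpow_inv_iff_of_pos (h.nonneg z) (by positivity) (hexp.p_pos z)]
    _ = A ^ (1 / p z) * R ^ (-(Q x / p z)) := by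
        rw [Real.mul_rpow (by linarith) (by positivity), ← Real.rpow_mul hR.le, mul_one_div,
          neg_div]
    _ ≤ A ^ Λ * (rpowConst Λ δ 1 * R ^ (-(Q x / p x))) := by
        gcongr
        exact hexp.one_div_p_le z
    _ = _ := (mul_assoc _ _ _).symm

theorem abs_sub_le_stepConst_mul (hexp : RegularExponents Λ Q p ε)
    (h : HajlaszPair δ A Q p ε E S U H) (hK : 1 ≤ K) (hG : 0 ≤ G) (hR : 0 < R) (hRδ : R ≤ δ)
    {y z w : X} (hz : z ∈ S) (hw : w ∈ S) (hyx : dist y x ≤ K * R) (hzx : dist z x ≤ K * R)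
    (hwx : dist w x ≤ K * R) (hzw : dist z w ≤ K * R) (hHz : H z ≤ G * R ^ (-(Q x / p x)))
    (hHw : H w ≤ G * R ^ (-(Q y / p y))) :
    |U z - U w| ≤ stepConst Λ δ K G * R ^ holderExp Q p ε x := by
  have hxx : dist x x ≤ K * R := by
    rw [dist_self]
    positivity
  have hz_term := hexp.rpow_mul_le hK hG hR hRδ hzx hxx dist_nonneg hzw hHz
  have hw_term := hexp.rpow_mul_le hK hG hR hRδ hwx hyx dist_nonneg hzw hHw
  calc |U z - U w| ≤ _ := h.hajlasz_le z hz w hw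
    _ ≤ _ := add_le_add hz_term hw_term
    _ = _ := by
      unfold stepConst
      ring

theorem abs_sub_le_chainConst_mul_of_halved (hexp : RegularExponents Λ Q p ε)
    (h : HajlaszPair δ A Q p ε E S U H) (hA : 1 ≤ A) (hR : 0 < R) (hRδ : R ≤ δ) {z w : X}
    (hz : z ∈ S) (hw : w ∈ S) (hzx : dist z x < R) (hwx : dist w x < R / 2)
    (hHz : H z ≤ goodConst Λ δ A * R ^ (-(Q x / p x)))
    (hHw : H w ≤ goodConst Λ δ A * (R / 2) ^ (-(Q x / p x))) :
    |U z - U w| ≤ chainConst Λ δ A * R ^ holderExp Q p ε x := by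
  have hG : 0 < goodConst Λ δ A := goodConst_pos (by linarith)
  have hhalf : (R / 2) ^ (-(Q x / p x)) ≤ 2 ^ Λ ^ 2 * R ^ (-(Q x / p x)) := by
    rw [Real.div_rpow hR.le zero_le_two, Real.rpow_neg zero_le_two, div_inv_eq_mul, mul_comm]
    gcongr
    · exact one_le_two
    · exact hexp.Q_div_p_le x
  have hfull : R ^ (-(Q x / p x)) ≤ 2 ^ Λ ^ 2 * R ^ (-(Q x / p x)) :=
    le_mul_of_one_le_left (by positivity) (Real.one_le_rpow one_le_two (sq_nonneg Λ))
  have hzw : dist z w ≤ 2 * R := by linarith [dist_triangle_right z w x]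
  refine h.abs_sub_le_stepConst_mul hexp one_le_two (by positivity) hR hRδ (y := x) hz hw
    (by rw [dist_self]; positivity) (by linarith) (by linarith) hzw ?_ ?_
  · rw [mul_comm (2 ^ Λ ^ 2), mul_assoc]
    exact hHz.trans (mul_le_mul_of_nonneg_left hfull hG.le)
  · rw [mul_comm (2 ^ Λ ^ 2), mul_assoc]
    exact hHw.trans (mul_le_mul_of_nonneg_left hhalf hG.le)

theorem abs_sub_le_add_chainConst_mul (hexp : RegularExponents Λ Q p ε)
    (h : HajlaszPair δ A Q p ε E S U H) (hA : 1 ≤ A) (hR : 0 < R) (hRδ : R ≤ δ) {z : X}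
    (hx : x ∈ S) (hz : z ∈ S) (hzx : dist z x < R)
    (hHz : H z ≤ goodConst Λ δ A * R ^ (-(Q x / p x))) :
    |U x - U z| ≤ R ^ ε x * H x + chainConst Λ δ A * R ^ holderExp Q p ε x := by
  have hG : 0 < goodConst Λ δ A := goodConst_pos (by linarith)
  have hR2 : R ≤ 2 * R := by linarith
  have hd : dist x z ≤ R := by
    rw [dist_comm]
    exact hzx.le
  have hx_term : dist x z ^ ε x * H x ≤ R ^ ε x * H x :=
    mul_le_mul_of_nonneg_right (Real.rpow_le_rpow dist_nonneg hd (hexp.ε_pos x).le) (h.nonneg x)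
  have hz_term := hexp.rpow_mul_le (x := x) (y := x) one_le_two hG.le hR hRδ (hzx.le.trans hR2)
    (by rw [dist_self]; positivity) dist_nonneg (hd.trans hR2) hHz
  have hconst : 2 ^ Λ * rpowConst Λ δ 2 ^ 2 * goodConst Λ δ A ≤ chainConst Λ δ A := by
    have hone : (1 : ℝ) ≤ 2 * 2 ^ Λ ^ 2 := by
      linarith [Real.one_le_rpow one_le_two (sq_nonneg Λ)]
    have := rpowConst_pos Λ δ 2
    calc _ ≤ 2 * 2 ^ Λ ^ 2 * (2 ^ Λ * rpowConst Λ δ 2 ^ 2 * goodConst Λ δ A) :=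
          le_mul_of_one_le_left (by positivity) hone
      _ = _ := by
        unfold chainConst stepConst
        ring
  exact (h.hajlasz_le x hx z hz).trans (add_le_add hx_term (hz_term.trans
    (mul_le_mul_of_nonneg_right hconst (by positivity))))

theorem exists_chain_bound (hexp : RegularExponents Λ Q p ε) (h : HajlaszPair δ A Q p ε E S U H)
    (hA : 1 ≤ A) (hR : 0 < R) (hRδ : R ≤ δ) (hx : x ∈ S) (hsub : Metric.ball x R ⊆ E) :
    ∃ z ∈ S, dist z x < R ∧ H z ≤ goodConst Λ δ A * R ^ (-(Q x / p x)) ∧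
      ∀ n : ℕ, |U x - U z| ≤ chainConst Λ δ A * ((R / 2 ^ n) ^ ε x * H x +
        ∑ j ∈ Finset.range (n + 1), (R / 2 ^ j) ^ holderExp Q p ε x) := by
  have hr : ∀ n : ℕ, 0 < R / 2 ^ n := fun n => by positivity
  have hrR : ∀ n : ℕ, R / 2 ^ n ≤ R := fun n => div_le_self hR.le (one_le_pow₀ one_le_two)
  choose z hzS hzx hHz using fun n : ℕ => h.exists_le_goodConst_mul hexp hA (x := x) (hr n)
    ((hrR n).trans hRδ) ((Metric.ball_subset_ball (hrR n)).trans hsub)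
  refine ⟨z 0, hzS 0, by simpa using hzx 0, by simpa using hHz 0, fun n => ?_⟩
  have hstep : ∀ j, dist (U (z j)) (U (z (j + 1))) ≤
      chainConst Λ δ A * (R / 2 ^ j) ^ holderExp Q p ε x := fun j => by
    have hhalf : R / 2 ^ (j + 1) = R / 2 ^ j / 2 := by rw [pow_succ, div_div]
    exact h.abs_sub_le_chainConst_mul_of_halved hexp hA (hr j) ((hrR j).trans hRδ) (hzS j)
      (hzS (j + 1)) (hzx j) (hhalf ▸ hzx (j + 1)) (hHz j) (hhalf ▸ hHz (j + 1))
  have htelescope : |U (z n) - U (z 0)| ≤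
      ∑ j ∈ Finset.range n, chainConst Λ δ A * (R / 2 ^ j) ^ holderExp Q p ε x := by
    rw [abs_sub_comm]
    exact dist_le_range_sum_of_dist_le n fun {j} _ => hstep j
  have hlast := h.abs_sub_le_add_chainConst_mul hexp hA (hr n) ((hrR n).trans hRδ) hx (hzS n)
    (hzx n) (hHz n)
  have hhead : (R / 2 ^ n) ^ ε x * H x ≤ chainConst Λ δ A * ((R / 2 ^ n) ^ ε x * H x) :=
    le_mul_of_one_le_left (mul_nonneg (by positivity) (h.nonneg x))
      (one_le_chainConst hexp.pos.le hA)
  rw [mul_add, Finset.sum_range_succ, mul_add, Finset.mul_sum]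
  linarith [abs_sub_le (U x) (U (z n)) (U (z 0))]

theorem exists_ball_chain_bound (hexp : RegularExponents Λ Q p ε)
    (h : HajlaszPair δ A Q p ε (Metric.ball x₀ (σ * r₀)) S U H) (hA : 1 ≤ A) (hσ : 1 < σ)
    (hr₀ : 0 < r₀) (hRδ : (σ - 1) * r₀ ≤ δ) :
    ∃ c : ℝ, ∀ x ∈ S ∩ Metric.ball x₀ r₀, ∀ n : ℕ,
      |U x - c| ≤ ballChainConst Λ δ A σ * (((σ - 1) * r₀ / 2 ^ n) ^ ε x * H x +
        ∑ j ∈ Finset.range (n + 1), ((σ - 1) * r₀ / 2 ^ j) ^ holderExp Q p ε x) := by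
  have hσ1 : 0 < σ - 1 := sub_pos.2 hσ
  set R := (σ - 1) * r₀ with hR_def
  have hR : 0 < R := mul_pos hσ1 hr₀
  have hKR : (2 + 1 / (σ - 1)) * R = 2 * R + r₀ := by
    rw [hR_def]
    field_simp
  have hK : 1 ≤ 2 + 1 / (σ - 1) := by linarith [one_div_pos.2 hσ1]
  obtain ⟨v, hvS, hvx₀, hHv⟩ := h.exists_le_goodConst_mul hexp hA hR hRδ
    (Metric.ball_subset_ball (by nlinarith))
  refine ⟨U v, fun x hx n => ?_⟩
  have hxx₀ : dist x₀ x < r₀ := by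
    rw [dist_comm]
    exact hx.2
  obtain ⟨z, hzS, hzx, hHz, hchain⟩ := h.exists_chain_bound hexp hA hR hRδ hx.1
    (Metric.ball_subset_ball' (by rw [dist_comm]; nlinarith))
  have hjump := h.abs_sub_le_stepConst_mul hexp hK (goodConst_pos (by linarith)).le hR hRδ hzS hvS
    (x := x) (y := x₀) (by linarith) (by linarith) (by linarith [dist_triangle v x₀ x])
    (by linarith [dist_triangle_right z v x, dist_triangle v x₀ x]) hHz hHv
  set step := stepConst Λ δ (2 + 1 / (σ - 1)) (goodConst Λ δ A)
  have hstep : 0 < step := stepConst_pos (by linarith) (goodConst_pos (by linarith))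
  have hfirst : R ^ holderExp Q p ε x ≤
      ∑ j ∈ Finset.range (n + 1), (R / 2 ^ j) ^ holderExp Q p ε x := by
    simpa using Finset.single_le_sum (f := fun j : ℕ => (R / 2 ^ j) ^ holderExp Q p ε x)
      (fun j _ => by positivity) (Finset.mem_range.2 n.succ_pos)
  have hhead : 0 ≤ (R / 2 ^ n) ^ ε x * H x := mul_nonneg (by positivity) (h.nonneg x)
  calc |U x - U v| ≤ |U x - U z| + |U z - U v| := abs_sub_le _ _ _
    _ ≤ _ := add_le_add (hchain n) (hjump.trans (mul_le_mul_of_nonneg_left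
        (hfirst.trans (le_add_of_nonneg_left hhead)) hstep.le))
    _ = _ := (add_mul _ _ _).symm

end HajlaszPair

end Chaining

/-- The sum of the geometric series `∑ j, 2 ^ (-κ * j)`. -/
noncomputable def dyadicSum (κ : ℝ) : ℝ := (1 - 2 ^ (-κ))⁻¹

section Dyadic

variable {R h e β κ L : ℝ}

theorem dyadicSum_pos (hκ : 0 < κ) : 0 < dyadicSum κ :=
  inv_pos.2 (sub_pos.2 (Real.rpow_lt_one_of_one_lt_of_neg one_lt_two (neg_neg_of_pos hκ)))

theorem dyadicSum_eq_tsum (hκ : 0 < κ) : dyadicSum κ = ∑' j : ℕ, ((2 : ℝ) ^ (-κ)) ^ j :=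
  (tsum_geometric_of_lt_one (by positivity)
    (Real.rpow_lt_one_of_one_lt_of_neg one_lt_two (neg_neg_of_pos hκ))).symm

theorem sum_range_rpow_neg_pow_le_dyadicSum (hκ : 0 < κ) (n : ℕ) :
    ∑ j ∈ Finset.range n, ((2 : ℝ) ^ (-κ)) ^ j ≤ dyadicSum κ := by
  rw [dyadicSum_eq_tsum hκ]
  exact (summable_geometric_of_lt_one (by positivity) (Real.rpow_lt_one_of_one_lt_of_neg one_lt_two
    (neg_neg_of_pos hκ))).sum_le_tsum _ fun j _ => by positivity

theorem div_two_pow_rpow (hR : 0 ≤ R) (a : ℝ) (j : ℕ) :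
    (R / 2 ^ j) ^ a = ((2 : ℝ) ^ (-a)) ^ j * R ^ a := by
  rw [Real.div_rpow hR (by positivity), div_eq_mul_inv, mul_comm, ← Real.rpow_pow_comm zero_le_two,
    ← inv_pow, Real.rpow_neg zero_le_two]

theorem sum_div_two_pow_rpow_le_first (hR : 0 ≤ R) (hκ : 0 < κ) {a : ℝ} (ha : κ ≤ a) (n : ℕ) :
    ∑ j ∈ Finset.range n, (R / 2 ^ j) ^ a ≤ dyadicSum κ * R ^ a := by
  have hterm : ∀ j, (R / 2 ^ j) ^ a ≤ ((2 : ℝ) ^ (-κ)) ^ j * R ^ a := fun j => by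
    rw [div_two_pow_rpow hR]
    gcongr
    exact one_le_two
  calc ∑ j ∈ Finset.range n, (R / 2 ^ j) ^ a
      ≤ (∑ j ∈ Finset.range n, ((2 : ℝ) ^ (-κ)) ^ j) * R ^ a := by
        rw [Finset.sum_mul]
        exact Finset.sum_le_sum fun j _ => hterm j
    _ ≤ _ := by
        gcongr
        exact sum_range_rpow_neg_pow_le_dyadicSum hκ n

theorem sum_div_two_pow_rpow_le_last (hR : 0 ≤ R) (hκ : 0 < κ) {a : ℝ} (ha : a ≤ -κ) (n : ℕ) :
    ∑ j ∈ Finset.range (n + 1), (R / 2 ^ j) ^ a ≤ dyadicSum κ * (R / 2 ^ n) ^ a := by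
  have hterm : ∀ j ∈ Finset.range (n + 1),
      (R / 2 ^ (n - j)) ^ a ≤ ((2 : ℝ) ^ (-κ)) ^ j * (R / 2 ^ n) ^ a := fun j hj => by
    have hscale : R / 2 ^ (n - j) = 2 ^ j * (R / 2 ^ n) := by
      rw [pow_sub₀ _ two_ne_zero (Finset.mem_range_succ_iff.1 hj)]
      field_simp
    rw [hscale, Real.mul_rpow (by positivity) (by positivity), ← Real.rpow_pow_comm zero_le_two]
    gcongr
    exact one_le_two
  calc ∑ j ∈ Finset.range (n + 1), (R / 2 ^ j) ^ a
      = ∑ j ∈ Finset.range (n + 1), (R / 2 ^ (n - j)) ^ a :=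
        (Finset.sum_range_reflect (fun j => (R / 2 ^ j) ^ a) (n + 1)).symm
    _ ≤ (∑ j ∈ Finset.range (n + 1), ((2 : ℝ) ^ (-κ)) ^ j) * (R / 2 ^ n) ^ a := by
        rw [Finset.sum_mul]
        exact Finset.sum_le_sum hterm
    _ ≤ _ := by
        gcongr
        exact sum_range_rpow_neg_pow_le_dyadicSum hκ (n + 1)

theorem exists_dyadic_balance (hR : 0 < R) (hβ : 0 < β) (hh : R ^ (-β) < h) :
    ∃ (t : ℝ) (n : ℕ), 0 < t ∧ t ^ (-β) = h ∧ R / 2 ^ (n + 1) ≤ t ∧ t ≤ R / 2 ^ n := by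
  have hh₀ : 0 < h := lt_trans (by positivity) hh
  obtain ⟨t, ht, rfl⟩ : ∃ t : ℝ, 0 < t ∧ t ^ (-β) = h := ⟨h ^ (-β)⁻¹, by positivity, by
    rw [← Real.rpow_mul hh₀.le, inv_mul_cancel₀ (neg_ne_zero.2 hβ.ne'), Real.rpow_one]⟩
  have htR : t ≤ R := ((Real.rpow_lt_rpow_iff_of_neg hR ht (neg_neg_of_pos hβ)).1 hh).le
  obtain ⟨n, hn, hn'⟩ := exists_nat_pow_near ((one_le_div ht).2 htR) one_lt_two
  refine ⟨t, n, ht, rfl, ?_, ?_⟩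
  · exact (div_le_comm₀ ht (by positivity)).1 hn'.le
  · exact (le_div_comm₀ (by positivity) ht).1 hn

theorem rpow_le_two_rpow_mul_rpow {t r : ℝ} (ht : 0 < t) (hr : t / 2 ≤ r) (heβ : e ≤ β)
    (hL : β - e ≤ L) : r ^ (e - β) ≤ 2 ^ L * t ^ (e - β) :=
  calc r ^ (e - β) ≤ (t / 2) ^ (e - β) :=
        Real.rpow_le_rpow_of_nonpos (by positivity) hr (by linarith)
    _ = 2 ^ (β - e) * t ^ (e - β) := by
        simpa using div_two_pow_rpow ht.le (e - β) 1
    _ ≤ _ := by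
        gcongr
        exact one_le_two

theorem exists_dyadic_sobolev_le (hR : 0 < R) (hh : 0 ≤ h) (he : 0 ≤ e) (hβ : 0 < β) (hκ : 0 < κ)
    (heβ : e - β ≤ -κ) (hL : β - e ≤ L) :
    ∃ n : ℕ, (R / 2 ^ n) ^ e * h + ∑ j ∈ Finset.range (n + 1), (R / 2 ^ j) ^ (e - β) ≤
      (2 + dyadicSum κ * 2 ^ L) * (R ^ (e - β) + h ^ (1 - e / β)) := by
  have hD := dyadicSum_pos hκ
  have hγ : 0 ≤ h ^ (1 - e / β) := Real.rpow_nonneg hh _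
  rcases le_or_gt h (R ^ (-β)) with hle | hgt
  · refine ⟨0, ?_⟩
    have hhead : R ^ e * h ≤ R ^ (e - β) := by
      rw [sub_eq_add_neg, Real.rpow_add hR]
      gcongr
    have : 0 < R ^ (e - β) := by positivity
    simp only [pow_zero, div_one, zero_add, Finset.range_one, Finset.sum_singleton]
    calc R ^ e * h + R ^ (e - β) ≤ 2 * (R ^ (e - β) + h ^ (1 - e / β)) := by linarith
      _ ≤ _ := by
        gcongr
        linarith [mul_pos hD (Real.rpow_pos_of_pos two_pos L)]
  · obtain ⟨t, n, ht, rfl, hnt, htn⟩ := exists_dyadic_balance hR hβ hgt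
    refine ⟨n + 1, ?_⟩
    have htα : (t ^ (-β)) ^ (1 - e / β) = t ^ (e - β) := by
      rw [← Real.rpow_mul ht.le]
      congr 1
      field_simp
      ring
    have hhead : (R / 2 ^ (n + 1)) ^ e * t ^ (-β) ≤ t ^ (e - β) := by
      rw [sub_eq_add_neg, Real.rpow_add ht]
      gcongr
    have hhalf : t / 2 ≤ R / 2 ^ (n + 1) := by
      rw [pow_succ, ← div_div]
      linarith
    have hsum := (sum_div_two_pow_rpow_le_last hR.le hκ heβ (n + 1)).trans <|
      mul_le_mul_of_nonneg_left (rpow_le_two_rpow_mul_rpow ht hhalf (by linarith) hL) hD.le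
    have hRα : 0 < R ^ (e - β) := by positivity
    calc _ ≤ (1 + dyadicSum κ * 2 ^ L) * t ^ (e - β) := by linarith
      _ ≤ _ := by
        rw [htα]
        gcongr <;> linarith

theorem exists_dyadic_exponential_scale (hR : 0 < R) (he : 0 < e) (h : ℝ) :
    ∃ n : ℕ, (R / 2 ^ n) ^ e * h ≤ 1 ∧ (2 : ℝ) ^ n ≤ 2 * max 1 (R * h ^ (1 / e)) := by
  rcases le_or_gt h (R ^ (-e)) with hle | hgt
  · refine ⟨0, ?_, by rw [pow_zero]; linarith [le_max_left 1 (R * h ^ (1 / e))]⟩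
    rw [pow_zero, div_one, ← Real.rpow_zero R, ← add_neg_cancel e, Real.rpow_add hR]
    gcongr
  · obtain ⟨t, n, ht, rfl, hnt, htn⟩ := exists_dyadic_balance hR he hgt
    refine ⟨n + 1, ?_, ?_⟩
    · rw [← Real.rpow_zero t, ← add_neg_cancel e, Real.rpow_add ht]
      gcongr
    · have hinv : (t ^ (-e)) ^ (1 / e) = t⁻¹ := by
        rw [← Real.rpow_mul ht.le, neg_mul, mul_one_div_cancel he.ne', Real.rpow_neg_one]
      rw [hinv, ← div_eq_mul_inv, pow_succ, mul_comm]
      gcongr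
      exact le_max_of_le_right ((le_div_comm₀ ht (by positivity)).1 htn)

end Dyadic

/-- The factor relating `((σ - 1) * r₀) ^ f x` and `r₀ ^ f x₀` for `x ∈ B(x₀, r₀)`, where `f` is
one of the exponents covered by `rpowConst` and `|f x| ≤ Λ ^ 2`. -/
noncomputable def radiusConst (Λ δ σ : ℝ) : ℝ :=
  (max (σ - 1) (σ - 1)⁻¹) ^ Λ ^ 2 * rpowConst Λ δ 1

/-- The constant in the pointwise Sobolev bound. -/
noncomputable def sobolevChainConst (Λ δ A σ : ℝ) : ℝ :=
  ballChainConst Λ δ A σ * (2 + dyadicSum (Λ ^ 2)⁻¹ * 2 ^ Λ ^ 2)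

/-- The exponential rate in the pointwise Moser–Trudinger bound. -/
noncomputable def moserTrudingerChainRate (Λ δ A σ : ℝ) : ℝ :=
  Real.log 2 / Λ / ballChainConst Λ δ A σ

/-- The constant in the Hölder bound for two points which are chained, at scale `R`, to points
within distance `K * R` of each other. -/
noncomputable def holderChainConst (Λ δ A K : ℝ) : ℝ :=
  chainConst Λ δ A * dyadicSum (Λ ^ 2)⁻¹ * (1 + rpowConst Λ δ K) +
    stepConst Λ δ K (goodConst Λ δ A)

theorem radiusConst_pos {Λ δ σ : ℝ} (hσ : 1 < σ) : 0 < radiusConst Λ δ σ :=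
  mul_pos (Real.rpow_pos_of_pos (lt_max_of_lt_left (sub_pos.2 hσ)) _) (rpowConst_pos Λ δ 1)

theorem ballChainConst_pos {Λ δ A σ : ℝ} (hA : 0 < A) (hσ : 1 < σ) :
    0 < ballChainConst Λ δ A σ := by
  have hG : 0 < goodConst Λ δ A := goodConst_pos hA
  have : 0 < 1 / (σ - 1) := one_div_pos.2 (sub_pos.2 hσ)
  exact add_pos (stepConst_pos two_pos (by positivity)) (stepConst_pos (by positivity) hG)

theorem sobolevChainConst_pos {Λ δ A σ : ℝ} (hΛ : 0 < Λ) (hA : 0 < A) (hσ : 1 < σ) :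
    0 < sobolevChainConst Λ δ A σ := by
  have := dyadicSum_pos (inv_pos.2 (pow_pos hΛ 2))
  exact mul_pos (ballChainConst_pos hA hσ) (by positivity)

theorem moserTrudingerChainRate_pos {Λ δ A σ : ℝ} (hΛ : 0 < Λ) (hA : 0 < A) (hσ : 1 < σ) :
    0 < moserTrudingerChainRate Λ δ A σ :=
  div_pos (div_pos (Real.log_pos one_lt_two) hΛ) (ballChainConst_pos hA hσ)

theorem holderChainConst_pos {Λ δ A K : ℝ} (hΛ : 0 < Λ) (hA : 0 < A) (hK : 0 < K) :
    0 < holderChainConst Λ δ A K := by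
  have hG : 0 < goodConst Λ δ A := goodConst_pos hA
  have hchain : 0 < chainConst Λ δ A := stepConst_pos two_pos (by positivity)
  have hD := dyadicSum_pos (inv_pos.2 (pow_pos hΛ 2))
  have hC := rpowConst_pos Λ δ K
  exact add_pos (by positivity) (stepConst_pos hK hG)

theorem exp_log_two_mul_le {Λ a m : ℝ} {n : ℕ} (hΛ : 1 ≤ Λ) (ha : Λ⁻¹ ≤ a) (hm : 1 ≤ m)
    (hn : (2 : ℝ) ^ n ≤ 2 * m) : Real.exp (Real.log 2 * (n + 2) * Λ⁻¹) ≤ 8 * m ^ a := calc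
  _ = (2 ^ n * 4 : ℝ) ^ Λ⁻¹ := by
    rw [Real.exp_mul, Real.exp_mul, Real.exp_log two_pos, Real.rpow_add two_pos,
      Real.rpow_natCast]
    norm_num
  _ ≤ (8 * m) ^ Λ⁻¹ := Real.rpow_le_rpow (by positivity) (by linarith) (by positivity)
  _ = 8 ^ Λ⁻¹ * m ^ Λ⁻¹ := Real.mul_rpow (by norm_num) (by linarith)
  _ ≤ 8 ^ (1 : ℝ) * m ^ a := by
    gcongr
    · norm_num
    · exact inv_le_one_of_one_le₀ hΛ
  _ = 8 * m ^ a := by rw [Real.rpow_one]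

theorem max_one_rpow_le {y : ℝ} (hy : 0 ≤ y) (a : ℝ) : (max 1 y) ^ a ≤ 1 + y ^ a := by
  rcases max_choice 1 y with h | h <;> rw [h]
  · rw [Real.one_rpow]
    exact le_add_of_nonneg_right (Real.rpow_nonneg hy a)
  · exact le_add_of_nonneg_left zero_le_one

section Pointwise

variable {X : Type*} [MetricSpace X] {Λ δ A σ K R r₀ : ℝ} {Q p ε : X → ℝ}
  {E S : Set X} {U H : X → ℝ} {x x₀ : X}

namespace RegularExponents

theorem radius_rpow_le (hexp : RegularExponents Λ Q p ε) {f : X → ℝ}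
    (hf : LogHolderWith (3 * Λ ^ 4) f) (hfx : |f x| ≤ Λ ^ 2) (hσ : 1 < σ) (hr₀ : 0 < r₀)
    (hr₀δ : r₀ ≤ δ) (hx : dist x x₀ < r₀) :
    ((σ - 1) * r₀) ^ f x ≤ radiusConst Λ δ σ * r₀ ^ f x₀ := by
  have hσ1 : 0 < σ - 1 := sub_pos.2 hσ
  have := hexp.pos
  rw [Real.mul_rpow hσ1.le hr₀.le, radiusConst, mul_assoc]
  gcongr
  · exact rpow_le_max_inv_rpow hσ1 hfx
  · exact hf.rpow_le_mul_rpow le_rfl hr₀ hr₀δ (by linarith)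

theorem sobolevExp_le (h : RegularExponents Λ Q p ε) (hx : Λ⁻¹ ≤ Q x - ε x * p x) :
    sobolevExp Q p ε x ≤ Λ ^ 3 := calc
  sobolevExp Q p ε x ≤ Λ * Λ / Λ⁻¹ := by
    have := h.pos
    have := h.p_pos x
    unfold sobolevExp
    gcongr
    · exact h.Q_le x
    · exact h.p_le x
  _ = Λ ^ 3 := by rw [div_inv_eq_mul, pow_succ, pow_two]

theorem le_sobolevExp (h : RegularExponents Λ Q p ε) (hx : Λ⁻¹ ≤ Q x - ε x * p x) :
    Λ⁻¹ ≤ sobolevExp Q p ε x := by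
  refine (h.le_p x).trans ?_
  rw [sobolevExp, le_div_iff₀ ((inv_pos.2 h.pos).trans_le hx)]
  nlinarith [mul_pos (h.ε_pos x) (mul_pos (h.p_pos x) (h.p_pos x))]

theorem holderExp_mul_p (h : RegularExponents Λ Q p ε) (x : X) :
    holderExp Q p ε x * p x = ε x * p x - Q x := by
  rw [holderExp, sub_mul, div_mul_cancel₀ _ (h.p_pos x).ne']

theorem holderExp_mul_sobolevExp (h : RegularExponents Λ Q p ε) (hx : Λ⁻¹ ≤ Q x - ε x * p x) :
    holderExp Q p ε x * sobolevExp Q p ε x = -Q x := by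
  have hgap : Q x - ε x * p x ≠ 0 := ((inv_pos.2 h.pos).trans_le hx).ne'
  rw [sobolevExp, ← mul_div_assoc, mul_left_comm, h.holderExp_mul_p, ← neg_sub, mul_neg, neg_div,
    mul_div_cancel_right₀ _ hgap]

theorem one_sub_mul_sobolevExp (h : RegularExponents Λ Q p ε) (hx : Λ⁻¹ ≤ Q x - ε x * p x) :
    (1 - ε x / (Q x / p x)) * sobolevExp Q p ε x = p x := by
  have hgap : Q x - ε x * p x ≠ 0 := ((inv_pos.2 h.pos).trans_le hx).ne'
  have hQ := (h.Q_pos x).ne'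
  rw [sobolevExp, div_div_eq_mul_div, one_sub_div hQ, div_mul_div_comm, mul_left_comm,
    mul_div_mul_left _ _ hQ, mul_div_cancel_left₀ _ hgap]

theorem holderExp_le_neg (h : RegularExponents Λ Q p ε) (hx : Λ⁻¹ ≤ Q x - ε x * p x) :
    holderExp Q p ε x ≤ -(Λ ^ 2)⁻¹ := by
  have hp := h.p_pos x
  have hinv : (Λ ^ 2)⁻¹ * p x ≤ Λ⁻¹ := calc
    (Λ ^ 2)⁻¹ * p x ≤ (Λ ^ 2)⁻¹ * Λ := by
      gcongr
      exact h.p_le x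
    _ = Λ⁻¹ := by
      have := h.pos.ne'
      field_simp
  rw [← mul_le_mul_iff_left₀ hp, h.holderExp_mul_p]
  linarith

theorem le_holderExp (h : RegularExponents Λ Q p ε) (hx : Λ⁻¹ ≤ ε x * p x - Q x) :
    (Λ ^ 2)⁻¹ ≤ holderExp Q p ε x := by
  have hp := h.p_pos x
  have hinv : (Λ ^ 2)⁻¹ * p x ≤ Λ⁻¹ := calc
    (Λ ^ 2)⁻¹ * p x ≤ (Λ ^ 2)⁻¹ * Λ := by
      gcongr
      exact h.p_le x
    _ = Λ⁻¹ := by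
      have := h.pos.ne'
      field_simp
  rw [← mul_le_mul_iff_left₀ hp, h.holderExp_mul_p]
  linarith

end RegularExponents

theorem add_rpow_le_two_rpow_mul {a c γ : ℝ} (ha : 0 ≤ a) (hc : 0 ≤ c) (hγ : 0 ≤ γ) :
    (a + c) ^ γ ≤ 2 ^ γ * (a ^ γ + c ^ γ) := calc
  (a + c) ^ γ ≤ (2 * max a c) ^ γ := by
    gcongr
    linarith [le_max_left a c, le_max_right a c]
  _ = 2 ^ γ * (max a c) ^ γ := Real.mul_rpow zero_le_two (le_max_of_le_left ha)
  _ ≤ _ := by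
    gcongr
    rcases max_choice a c with h | h <;> rw [h]
    · exact le_add_of_nonneg_right (Real.rpow_nonneg hc γ)
    · exact le_add_of_nonneg_left (Real.rpow_nonneg ha γ)

namespace HajlaszPair

theorem exists_sobolev_bound (hexp : RegularExponents Λ Q p ε)
    (h : HajlaszPair δ A Q p ε (Metric.ball x₀ (σ * r₀)) S U H) (hA : 1 ≤ A) (hσ : 1 < σ)
    (hr₀ : 0 < r₀) (hRδ : (σ - 1) * r₀ ≤ δ) (hgap : ∀ x, Λ⁻¹ ≤ Q x - ε x * p x) :
    ∃ c : ℝ, ∀ x ∈ S ∩ Metric.ball x₀ r₀, |U x - c| ≤ sobolevChainConst Λ δ A σ *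
      (((σ - 1) * r₀) ^ holderExp Q p ε x + H x ^ (1 - ε x / (Q x / p x))) := by
  obtain ⟨c, hc⟩ := h.exists_ball_chain_bound hexp hA hσ hr₀ hRδ
  refine ⟨c, fun x hx => ?_⟩
  have hC : 0 < ballChainConst Λ δ A σ := ballChainConst_pos (by linarith) hσ
  obtain ⟨n, hn⟩ := exists_dyadic_sobolev_le (mul_pos (sub_pos.2 hσ) hr₀) (h.nonneg x)
    (hexp.ε_pos x).le (hexp.Q_div_p_pos x) (inv_pos.2 (pow_pos hexp.pos 2))
    (hexp.holderExp_le_neg (hgap x))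
    ((neg_sub (ε x) _).symm.trans_le ((neg_le_abs _).trans (hexp.abs_holderExp_le x)))
  rw [sobolevChainConst, mul_assoc]
  exact (hc x hx n).trans (mul_le_mul_of_nonneg_left hn hC.le)

theorem exists_sobolev_rpow_bound (hexp : RegularExponents Λ Q p ε)
    (h : HajlaszPair δ A Q p ε (Metric.ball x₀ (σ * r₀)) S U H) (hA : 1 ≤ A) (hσ : 1 < σ)
    (hr₀ : 0 < r₀) (hr₀δ : r₀ ≤ δ) (hRδ : (σ - 1) * r₀ ≤ δ)
    (hgap : ∀ x, Λ⁻¹ ≤ Q x - ε x * p x) :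
    ∃ c : ℝ, ∀ x ∈ S ∩ Metric.ball x₀ r₀,
      (|U x - c| / sobolevChainConst Λ δ A σ) ^ sobolevExp Q p ε x ≤
        2 ^ Λ ^ 3 * (radiusConst Λ δ σ * r₀ ^ (-Q x₀) + H x ^ p x) := by
  obtain ⟨c, hc⟩ := h.exists_sobolev_bound hexp hA hσ hr₀ hRδ hgap
  refine ⟨c, fun x hx => ?_⟩
  have hC : 0 < sobolevChainConst Λ δ A σ := sobolevChainConst_pos hexp.pos (by linarith) hσ
  have hR : 0 < (σ - 1) * r₀ := mul_pos (sub_pos.2 hσ) hr₀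
  have hH := h.nonneg x
  have hγ : 0 ≤ sobolevExp Q p ε x :=
    (inv_pos.2 hexp.pos).le.trans (hexp.le_sobolevExp (hgap x))
  have hQΛ : |-Q x| ≤ Λ ^ 2 := by
    rw [abs_neg]
    exact (hexp.abs_Q_le x).trans (le_self_pow₀ hexp.one_le two_ne_zero)
  calc _ ≤ (((σ - 1) * r₀) ^ holderExp Q p ε x +
          H x ^ (1 - ε x / (Q x / p x))) ^ sobolevExp Q p ε x :=
        Real.rpow_le_rpow (by positivity) ((div_le_iff₀' hC).2 (hc x hx)) hγ
    _ ≤ 2 ^ sobolevExp Q p ε x * (((σ - 1) * r₀) ^ (-Q x) + H x ^ p x) := by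
        refine (add_rpow_le_two_rpow_mul (by positivity) (by positivity) hγ).trans_eq ?_
        rw [← Real.rpow_mul hR.le, ← Real.rpow_mul hH, hexp.holderExp_mul_sobolevExp (hgap x),
          hexp.one_sub_mul_sobolevExp (hgap x)]
    _ ≤ _ := by
        have := Real.rpow_nonneg hH (p x)
        gcongr
        · exact one_le_two
        · exact hexp.sobolevExp_le (hgap x)
        · exact hexp.radius_rpow_le hexp.logHolder_Q.neg hQΛ hσ hr₀ hr₀δ hx.2

theorem exists_exponential_bound (hexp : RegularExponents Λ Q p ε)
    (h : HajlaszPair δ A Q p ε (Metric.ball x₀ (σ * r₀)) S U H) (hA : 1 ≤ A) (hσ : 1 < σ)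
    (hr₀ : 0 < r₀) (hr₀δ : r₀ ≤ δ) (hRδ : (σ - 1) * r₀ ≤ δ) (hQε : ∀ x, ε x * p x = Q x) :
    ∃ c : ℝ, ∀ x ∈ S ∩ Metric.ball x₀ r₀,
      Real.exp (moserTrudingerChainRate Λ δ A σ * |U x - c|) ≤
        8 * (1 + radiusConst Λ δ σ * r₀ ^ Q x₀ * H x ^ p x) := by
  obtain ⟨c, hc⟩ := h.exists_ball_chain_bound hexp hA hσ hr₀ hRδ
  refine ⟨c, fun x hx => ?_⟩
  set R := (σ - 1) * r₀
  have hR : 0 < R := mul_pos (sub_pos.2 hσ) hr₀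
  have hH := h.nonneg x
  have := Real.log_pos one_lt_two
  have hΛ1 := hexp.one_le
  have hC : 0 < ballChainConst Λ δ A σ := ballChainConst_pos (by linarith) hσ
  have hα : holderExp Q p ε x = 0 := by
    rw [holderExp, ← hQε, mul_div_cancel_right₀ _ (hexp.p_pos x).ne', sub_self]
  obtain ⟨n, hn, hn2⟩ := exists_dyadic_exponential_scale hR (hexp.ε_pos x) (H x)
  have hosc : |U x - c| ≤ ballChainConst Λ δ A σ * (n + 2) := by
    refine (hc x hx n).trans (mul_le_mul_of_nonneg_left ?_ hC.le)
    simp only [hα, Real.rpow_zero, Finset.sum_const, Finset.card_range, nsmul_eq_mul, mul_one]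
    push_cast
    linarith
  have hexponent : moserTrudingerChainRate Λ δ A σ * |U x - c| ≤ Real.log 2 * (n + 2) * Λ⁻¹ := by
    calc _ ≤ Real.log 2 / Λ / ballChainConst Λ δ A σ * (ballChainConst Λ δ A σ * (n + 2)) := by
          unfold moserTrudingerChainRate
          gcongr
      _ = _ := by
        field_simp
  have hpow : (R * H x ^ (1 / ε x)) ^ Q x = R ^ Q x * H x ^ p x := by
    rw [Real.mul_rpow hR.le (by positivity), ← Real.rpow_mul hH, ← hQε x, one_div,
      inv_mul_cancel_left₀ (hexp.ε_pos x).ne']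
  calc _ ≤ Real.exp (Real.log 2 * (n + 2) * Λ⁻¹) := Real.exp_le_exp.2 hexponent
    _ ≤ 8 * (max 1 (R * H x ^ (1 / ε x))) ^ Q x :=
        exp_log_two_mul_le hΛ1 (hexp.le_Q x) (le_max_left _ _) hn2
    _ ≤ 8 * (1 + R ^ Q x * H x ^ p x) := by
        rw [← hpow]
        gcongr
        exact max_one_rpow_le (by positivity) _
    _ ≤ 8 * (1 + radiusConst Λ δ σ * r₀ ^ Q x₀ * H x ^ p x) := by
        have := Real.rpow_nonneg hH (p x)
        gcongr
        exact hexp.radius_rpow_le hexp.logHolder_Q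
          ((hexp.abs_Q_le x).trans (le_self_pow₀ hΛ1 two_ne_zero)) hσ hr₀ hr₀δ hx.2

theorem exists_holder_chain_bound (hexp : RegularExponents Λ Q p ε)
    (h : HajlaszPair δ A Q p ε E S U H) (hA : 1 ≤ A) (hR : 0 < R) (hRδ : R ≤ δ)
    (hx : x ∈ S) (hsub : Metric.ball x R ⊆ E) (hα : (Λ ^ 2)⁻¹ ≤ holderExp Q p ε x) :
    ∃ z ∈ S, dist z x < R ∧ H z ≤ goodConst Λ δ A * R ^ (-(Q x / p x)) ∧
      |U x - U z| ≤ chainConst Λ δ A * dyadicSum (Λ ^ 2)⁻¹ * R ^ holderExp Q p ε x := by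
  obtain ⟨z, hz, hzx, hHz, hchain⟩ := h.exists_chain_bound hexp hA hR hRδ hx hsub
  refine ⟨z, hz, hzx, hHz, ?_⟩
  have hchain₀ : 0 ≤ chainConst Λ δ A :=
    zero_le_one.trans (one_le_chainConst hexp.pos.le hA)
  have hκ : 0 < (Λ ^ 2)⁻¹ := inv_pos.2 (pow_pos hexp.pos 2)
  have hzero : Filter.Tendsto (fun n : ℕ => (R / 2 ^ n) ^ ε x * H x) Filter.atTop (nhds 0) := by
    have hscale : Filter.Tendsto (fun n : ℕ => R / (2 : ℝ) ^ n) Filter.atTop (nhds 0) :=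
      tendsto_const_nhds.div_atTop (tendsto_pow_atTop_atTop_of_one_lt one_lt_two)
    simpa [Real.zero_rpow (hexp.ε_pos x).ne'] using
      (hscale.rpow_const (Or.inr (hexp.ε_pos x).le)).mul_const (H x)
  have hlim := (hzero.add_const (dyadicSum (Λ ^ 2)⁻¹ * R ^ holderExp Q p ε x)).const_mul
    (chainConst Λ δ A)
  rw [zero_add, ← mul_assoc] at hlim
  exact ge_of_tendsto' hlim fun n => (hchain n).trans (mul_le_mul_of_nonneg_left
    (add_le_add_right (sum_div_two_pow_rpow_le_first hR.le hκ hα (n + 1)) _) hchain₀)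

theorem abs_sub_le_holderChainConst_mul (hexp : RegularExponents Λ Q p ε)
    (h : HajlaszPair δ A Q p ε E S U H) (hA : 1 ≤ A) (hα : ∀ x, (Λ ^ 2)⁻¹ ≤ holderExp Q p ε x)
    (hK : 1 ≤ K) (hR : 0 < R) (hRδ : R ≤ δ) {y : X} (hx : x ∈ S) (hy : y ∈ S)
    (hxE : Metric.ball x R ⊆ E) (hyE : Metric.ball y R ⊆ E) (hxy : dist x y + 2 * R ≤ K * R) :
    |U x - U y| ≤ holderChainConst Λ δ A K * R ^ holderExp Q p ε x := by
  obtain ⟨z, hz, hzx, hHz, hxz⟩ := h.exists_holder_chain_bound hexp hA hR hRδ hx hxE (hα x)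
  obtain ⟨w, hw, hwy, hHw, hyw⟩ := h.exists_holder_chain_bound hexp hA hR hRδ hy hyE (hα y)
  have hdyx : dist y x ≤ K * R := by linarith [dist_comm x y]
  have hjump := h.abs_sub_le_stepConst_mul hexp hK (goodConst_pos (by linarith)).le hR hRδ hz hw
    hdyx (by linarith [dist_nonneg (x := x) (y := y)])
    (by linarith [dist_triangle w y x, dist_comm x y])
    (by linarith [dist_triangle4 z x y w, dist_comm y w]) hHz hHw
  have hcomp : R ^ holderExp Q p ε y ≤ rpowConst Λ δ K * R ^ holderExp Q p ε x :=
    hexp.logHolder_holderExp.rpow_le_mul_rpow hK hR hRδ hdyx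
  have hchain : 0 ≤ chainConst Λ δ A * dyadicSum (Λ ^ 2)⁻¹ :=
    mul_nonneg (zero_le_one.trans (one_le_chainConst hexp.pos.le hA))
      (dyadicSum_pos (inv_pos.2 (pow_pos hexp.pos 2))).le
  have hyw' := hyw.trans (mul_le_mul_of_nonneg_left hcomp hchain)
  rw [abs_sub_comm] at hyw'
  calc |U x - U y| ≤ |U x - U z| + |U z - U w| + |U w - U y| :=
        (abs_sub_le _ _ _).trans (add_le_add_left (abs_sub_le _ _ _) _)
    _ ≤ _ := by
        unfold holderChainConst
        linarith

theorem abs_sub_le_of_mem_ball (hexp : RegularExponents Λ Q p ε)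
    (h : HajlaszPair δ A Q p ε (Metric.ball x₀ (σ * r₀)) S U H) (hA : 1 ≤ A) (hσ : 1 < σ)
    (hRδ : (σ - 1) * r₀ ≤ δ) (hα : ∀ x, (Λ ^ 2)⁻¹ ≤ holderExp Q p ε x) {y : X}
    (hx : x ∈ S ∩ Metric.ball x₀ r₀) (hy : y ∈ S ∩ Metric.ball x₀ r₀) :
    |U x - U y| ≤ holderChainConst Λ δ A (3 + 2 / (σ - 1)) * dist x y ^ holderExp Q p ε x := by
  have hσ1 : 0 < σ - 1 := sub_pos.2 hσ
  have hK : 0 < 2 / (σ - 1) := div_pos two_pos hσ1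
  have hC : 0 < holderChainConst Λ δ A (3 + 2 / (σ - 1)) :=
    holderChainConst_pos hexp.pos (by linarith) (by linarith)
  rcases eq_or_ne x y with rfl | hxy
  · rw [sub_self, abs_zero]
    positivity
  have hd : 0 < dist x y := dist_pos.2 hxy
  have hxx₀ : dist x x₀ < r₀ := hx.2
  have hyx₀ : dist y x₀ < r₀ := hy.2
  set R := (σ - 1) / (σ + 1) * dist x y with hR_def
  have hR : 0 < R := by positivity
  have hRr₀ : R ≤ (σ - 1) * r₀ := by
    rw [hR_def, div_mul_eq_mul_div, mul_div_assoc]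
    gcongr
    rw [div_le_iff₀ (by linarith)]
    nlinarith [dist_triangle_right x y x₀]
  have hKR : (3 + 2 / (σ - 1)) * R = dist x y + 2 * R := by
    rw [hR_def]
    field_simp
    ring
  have hRd : R ≤ dist x y :=
    mul_le_of_le_one_left hd.le ((div_le_one (by linarith)).2 (by linarith))
  have hα₀ : 0 ≤ holderExp Q p ε x := (inv_nonneg.2 (sq_nonneg Λ)).trans (hα x)
  exact (h.abs_sub_le_holderChainConst_mul hexp hA hα (by linarith) hR (hRr₀.trans hRδ) hx.1 hy.1
    (Metric.ball_subset_ball' (by linarith)) (Metric.ball_subset_ball' (by linarith))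
    hKR.ge).trans (mul_le_mul_of_nonneg_left (Real.rpow_le_rpow hR.le hRd hα₀) hC.le)

end HajlaszPair

end Pointwise

section MetricMeasure

variable {X : Type*} [MetricSpace X] [MeasurableSpace X] {μ : Measure X}

theorem IsMetricMeasure.isOpenPosMeasure (h : IsMetricMeasure μ) :
    μ.IsOpenPosMeasure where
  open_pos U hU := fun ⟨x, hx⟩ => by
    obtain ⟨r, hr, hsub⟩ := Metric.isOpen_iff.1 hU x hx
    exact ((h x r hr).1.trans_le (measure_mono hsub)).ne'

theorem forall_le_of_ae_le [μ.IsOpenPosMeasure] {f g : X → ℝ} (hf : Continuous f)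
    (hg : Continuous g) (hfg : ∀ᵐ x ∂μ, f x ≤ g x) (x : X) : f x ≤ g x :=
  (isClosed_le hf hg).closure_subset (Measure.dense_of_ae hfg x)

theorem Setting.regularExponents {b δ Λ : ℝ} {Q p ε s : X → ℝ}
    (h : Setting b δ Λ μ Q p ε s) (hΛ : 0 < Λ) (x₀ : X) : RegularExponents Λ Q p ε := by
  have := h.metricMeasure.isOpenPosMeasure
  have hc := h.controlled
  have hQ := hc.log_Q.continuous_of_one_div h.Q_mem.pos
  have hp := hc.log_p.continuous_of_one_div h.p_mem.pos
  have hε := hc.log_ε.continuous_of_one_div h.ε_mem.pos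
  have lower {f : X → ℝ} (hf : Continuous f) (hfΛ : EssBetween μ Λ⁻¹ Λ f) (x : X) : Λ⁻¹ ≤ f x :=
    forall_le_of_ae_le continuous_const hf (hfΛ.mono fun _ hx => hx.1) x
  have upper {f : X → ℝ} (hf : Continuous f) (hfΛ : EssBetween μ Λ⁻¹ Λ f) (x : X) : f x ≤ Λ :=
    forall_le_of_ae_le hf continuous_const (hfΛ.mono fun _ hx => hx.2) x
  have hΛ₁ : 1 ≤ Λ := by
    by_contra! hlt
    linarith [lower hQ hc.bounds_Q x₀, upper hQ hc.bounds_Q x₀, (one_lt_inv₀ hΛ).2 hlt]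
  exact ⟨hΛ₁, lower hQ hc.bounds_Q, upper hQ hc.bounds_Q, lower hp hc.bounds_p,
    upper hp hc.bounds_p, lower hε hc.bounds_ε, upper hε hc.bounds_ε, hc.log_Q, hc.log_p, hc.log_ε⟩

end MetricMeasure

section Mixed

open Filter Topology

variable {X : Type*} [MeasurableSpace X] {μ : Measure X} {E : Set X}
  {Λ : ℝ} {p : X → ℝ} {q : X → ℝ≥0∞} {g : ℤ → X → ℝ≥0∞}

theorem div_ofReal_mul (y : ℝ≥0∞) {a : ℝ} (ha : 0 < a) (c : ℝ) :
    y / ENNReal.ofReal (a * c) = y / ENNReal.ofReal a / ENNReal.ofReal c := by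
  rw [ENNReal.ofReal_mul ha.le, div_eq_mul_inv,
    ENNReal.mul_inv (.inl (ENNReal.ofReal_pos.2 ha).ne') (.inl ENNReal.ofReal_ne_top),
    ← mul_assoc, ← div_eq_mul_inv, ← div_eq_mul_inv]

theorem modular_mono_ae (hp : ∀ x, 0 ≤ p x) {f₁ f₂ : X → ℝ≥0∞}
    (h : ∀ᵐ x ∂μ.restrict E, f₁ x ≤ f₂ x) : modular μ E p f₁ ≤ modular μ E p f₂ :=
  lintegral_mono_ae (h.mono fun x hx => ENNReal.rpow_le_rpow hx (hp x))

theorem modular_div_le {m : ℝ} (hm : 0 ≤ m) (hp : ∀ᵐ x ∂μ.restrict E, m ≤ p x) (f : X → ℝ≥0∞)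
    {c : ℝ} (hc : 1 ≤ c) :
    modular μ E p (fun x => f x / ENNReal.ofReal c) ≤
      ENNReal.ofReal (c⁻¹ ^ m) * modular μ E p f := by
  have hc₀ : 0 < c⁻¹ := inv_pos.2 (zero_lt_one.trans_le hc)
  rw [modular, modular, ← lintegral_const_mul' _ _ ENNReal.ofReal_ne_top]
  refine lintegral_mono_ae (hp.mono fun x hx => ?_)
  rw [div_eq_mul_inv, ← ENNReal.ofReal_inv_of_pos (inv_pos.1 hc₀),
    ENNReal.mul_rpow_of_nonneg _ _ (hm.trans hx), ENNReal.ofReal_rpow_of_pos hc₀, mul_comm]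
  gcongr ENNReal.ofReal ?_ * _
  exact Real.rpow_le_rpow_of_exponent_ge hc₀ (inv_le_one_of_one_le₀ hc) hx

theorem tendsto_modular_div_atTop (hΛ : 0 < Λ) (hp : ∀ x, Λ⁻¹ ≤ p x) {f : X → ℝ≥0∞}
    (hf : modular μ E p f < ∞) :
    Tendsto (fun c : ℝ => modular μ E p (fun x => f x / ENNReal.ofReal c)) atTop (𝓝 0) := by
  have hpow : Tendsto (fun c : ℝ => c⁻¹ ^ Λ⁻¹) atTop (𝓝 0) := by
    simpa only [Real.zero_rpow (inv_pos.2 hΛ).ne'] using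
      tendsto_inv_atTop_zero.rpow_const (.inr (inv_pos.2 hΛ).le)
  have hbound : Tendsto (fun c : ℝ => ENNReal.ofReal (c⁻¹ ^ Λ⁻¹) * modular μ E p f) atTop
      (𝓝 0) := by
    simpa only [ENNReal.ofReal_zero, zero_mul] using
      ENNReal.Tendsto.mul_const (ENNReal.tendsto_ofReal hpow) (.inr hf.ne)
  exact tendsto_of_tendsto_of_tendsto_of_le_of_le' tendsto_const_nhds hbound
    (.of_forall fun _ => zero_le)
    ((eventually_ge_atTop 1).mono fun _ => modular_div_le (inv_pos.2 hΛ).le (.of_forall hp) f)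

theorem IsExponentOn.exists_inv_toReal_le (hq : IsExponentOn μ E q) :
    ∃ M : ℝ, 0 < M ∧ ∀ᵐ x ∂μ.restrict E, ((q x)⁻¹).toReal ≤ M := by
  set m := min (essInf q (μ.restrict E)) 1
  have hm₀ : 0 < m := lt_min hq.essInf_pos one_pos
  have hm₁ : m ≠ ∞ := ((min_le_right _ _).trans_lt ENNReal.one_lt_top).ne
  have hm_inv : m⁻¹ ≠ ∞ := ENNReal.inv_ne_top.2 hm₀.ne'
  refine ⟨m⁻¹.toReal, ENNReal.toReal_pos (ENNReal.inv_ne_zero.2 hm₁) hm_inv, ?_⟩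
  filter_upwards [ae_essInf_le (f := q) (μ := μ.restrict E)] with x hx
  exact ENNReal.toReal_mono hm_inv (ENNReal.inv_le_inv.2 ((min_le_left _ _).trans hx))

/-- The `k`-th summand of the modular of `g / a` in `ℓ^{q(·)}(L^{p(·)}(E))`. -/
noncomputable def mixedSummand (μ : Measure X) (E : Set X) (p : X → ℝ) (q : X → ℝ≥0∞)
    (g : ℤ → X → ℝ≥0∞) (a : ℝ) (k : ℤ) : ℝ≥0∞ :=
  ⨅ (t : ℝ) (_ : 0 < t) (_ : modular μ E p (fun x => g k x / ENNReal.ofReal a /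
      ENNReal.ofReal (t ^ ((q x)⁻¹).toReal)) ≤ 1), ENNReal.ofReal t

theorem mixedSummand_anti (hp : ∀ x, 0 ≤ p x) {a c : ℝ} (hac : a ≤ c) (k : ℤ) :
    mixedSummand μ E p q g c k ≤ mixedSummand μ E p q g a k := by
  refine iInf_mono fun t => iInf_mono fun _ => iInf_mono' fun h => ⟨?_, le_rfl⟩
  refine (modular_mono_ae hp (.of_forall fun x => ?_)).trans h
  gcongr

theorem tendsto_mixedSummand_atTop (hΛ : 0 < Λ) (hp : ∀ x, Λ⁻¹ ≤ p x) (hq : IsExponentOn μ E q)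
    {k : ℤ} (hg : modular μ E p (g k) < ∞) :
    Tendsto (fun a => mixedSummand μ E p q g a k) atTop (𝓝 0) := by
  obtain ⟨M, -, hqM⟩ := hq.exists_inv_toReal_le
  rw [ENNReal.tendsto_nhds_zero]
  intro η hη
  obtain ⟨τ, hτ₀, hτ₁, hτη⟩ : ∃ τ : ℝ, 0 < τ ∧ τ ≤ 1 ∧ ENNReal.ofReal τ ≤ η := by
    have hmin : min η 1 ≠ ∞ := ((min_le_right _ _).trans_lt ENNReal.one_lt_top).ne
    refine ⟨(min η 1).toReal, ENNReal.toReal_pos (lt_min hη one_pos).ne' hmin,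
      ENNReal.toReal_le_of_le_ofReal zero_le_one (by simp), ?_⟩
    rw [ENNReal.ofReal_toReal hmin]
    exact min_le_left _ _
  have hτM : 0 < τ ^ M := Real.rpow_pos_of_pos hτ₀ M
  have hmod := ((tendsto_modular_div_atTop hΛ hp hg).comp
    (tendsto_id.atTop_mul_const hτM)).eventually (ge_mem_nhds zero_lt_one)
  filter_upwards [hmod, eventually_gt_atTop 0] with a ha ha₀
  refine (iInf_le_of_le τ (iInf_le_of_le hτ₀ (iInf_le _ ?_))).trans hτη
  refine (modular_mono_ae (fun x => (inv_pos.2 hΛ).le.trans (hp x)) ?_).trans ha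
  filter_upwards [hqM] with x hx
  rw [id, div_ofReal_mul _ ha₀]
  exact ENNReal.div_le_div_left
    (ENNReal.ofReal_le_ofReal (Real.rpow_le_rpow_of_exponent_ge hτ₀ hτ₁ hx)) _

theorem MemMixed.mixedNorm_lt_top (hΛ : 0 < Λ) (hp : ∀ x, Λ⁻¹ ≤ p x) (hq : IsExponentOn μ E q)
    (hg : MemMixed μ E p q g) : mixedNorm μ E p q g < ∞ := by
  obtain ⟨l, hl, hfin⟩ := hg.finite
  have htends : Tendsto (fun a : ℝ => ∑' k, mixedSummand μ E p q g a k) atTop (𝓝 0) := by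
    simpa only [lintegral_count, tsum_zero] using
      tendsto_lintegral_filter_of_dominated_convergence (μ := Measure.count)
        (mixedSummand μ E p q g l)
        (.of_forall fun a => measurable_from_top)
        ((eventually_ge_atTop l).mono fun a ha => .of_forall
          (mixedSummand_anti (fun x => (inv_pos.2 hΛ).le.trans (hp x)) ha))
        (by rw [lintegral_count]; exact hfin.ne)
        (.of_forall fun k => tendsto_mixedSummand_atTop hΛ hp hq (hg.memLp k))
  obtain ⟨a, ha₁, ha₀⟩ :=
    ((htends.eventually (ge_mem_nhds zero_lt_one)).and (eventually_gt_atTop 0)).exists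
  exact (iInf_le_of_le a (iInf_le_of_le ha₀ (iInf_le _ ha₁))).trans_lt ENNReal.ofReal_lt_top

theorem modular_div_le_one_of_mixedNorm_lt (hp : ∀ x, 0 ≤ p x) (hq : IsExponentOn μ E q) {a : ℝ}
    (h : mixedNorm μ E p q g < ENNReal.ofReal a) (k : ℤ) :
    modular μ E p (fun x => g k x / ENNReal.ofReal (2 * a)) ≤ 1 := by
  obtain ⟨M, hM, hqM⟩ := hq.exists_inv_toReal_le
  simp only [mixedNorm, iInf_lt_iff] at h
  obtain ⟨l, hl, hmod, hla⟩ := h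
  set η : ℝ := 2 ^ M⁻¹
  have hη : 1 < η := Real.one_lt_rpow one_lt_two (inv_pos.2 hM)
  have hk := ((ENNReal.le_tsum k).trans hmod).trans_lt (ENNReal.one_lt_ofReal.2 hη)
  simp only [iInf_lt_iff] at hk
  obtain ⟨t, ht, htmod, htη⟩ := hk
  refine (modular_mono_ae hp ?_).trans htmod
  filter_upwards [hqM] with x hx
  have ht_le : t ^ ((q x)⁻¹).toReal ≤ 2 :=
    calc t ^ ((q x)⁻¹).toReal ≤ η ^ ((q x)⁻¹).toReal :=
          Real.rpow_le_rpow ht.le ((ENNReal.ofReal_lt_ofReal_iff_of_nonneg ht.le).1 htη).le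
            ENNReal.toReal_nonneg
      _ ≤ η ^ M := Real.rpow_le_rpow_of_exponent_le hη.le hx
      _ = 2 := Real.rpow_inv_rpow zero_le_two hM.ne'
  rw [← div_ofReal_mul _ hl, mul_comm 2 a]
  exact ENNReal.div_le_div_left (ENNReal.ofReal_le_ofReal (mul_le_mul
    ((ENNReal.ofReal_lt_ofReal_iff_of_nonneg hl.le).1 hla).le ht_le (by positivity)
    (hl.le.trans ((ENNReal.ofReal_lt_ofReal_iff_of_nonneg hl.le).1 hla).le))) _

end Mixed

section Weights

/-- A bound for `d ^ t` when `2 ^ (-k - 1) ≤ d < 2 ^ (-k)`, `d ≤ 2 * δ` and `Λ⁻¹ ≤ t ≤ Λ`, decaying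
geometrically in `|k|`. -/
noncomputable def dyadicWeight (Λ δ : ℝ) (k : ℤ) : ℝ :=
  (1 + 2 * (2 * δ)) ^ (Λ + Λ⁻¹) * ((2⁻¹ : ℝ) ^ k.natAbs) ^ Λ⁻¹

/-- A bound for all powers `dyadicWeight Λ δ k ^ t` with `Λ⁻¹ ≤ t ≤ Λ`. -/
noncomputable def dyadicWeightBound (Λ δ : ℝ) (k : ℤ) : ℝ :=
  ((1 + 2 * (2 * δ)) ^ (Λ + Λ⁻¹)) ^ Λ * ((2⁻¹ : ℝ) ^ (Λ⁻¹ * Λ⁻¹)) ^ k.natAbs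

variable {Λ δ D d t : ℝ} {k : ℤ}

theorem min_one_le_mul_inv_two_pow (hd : 0 < d) (hdD : d ≤ D) (hkd : (2 : ℝ) ^ (-k - 1) ≤ d)
    (hdk : d < (2 : ℝ) ^ (-k)) : min 1 d ≤ (1 + 2 * D) * 2⁻¹ ^ k.natAbs := by
  have : 0 < D := hd.trans_le hdD
  rcases le_or_gt 0 k with hk | hk
  · lift k to ℕ using hk
    calc min 1 d ≤ 2⁻¹ ^ k := by
          rw [inv_pow, ← zpow_natCast, ← zpow_neg]
          exact (min_le_right _ _).trans hdk.le
      _ ≤ (1 + 2 * D) * 2⁻¹ ^ k := le_mul_of_one_le_left (by positivity) (by linarith)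
  · obtain ⟨n, rfl⟩ := Int.exists_eq_neg_ofNat hk.le
    rw [neg_neg, zpow_sub_one₀ two_ne_zero, zpow_natCast] at hkd
    rw [Int.natAbs_neg, Int.natAbs_natCast, inv_pow, ← div_eq_mul_inv]
    exact (min_le_left _ _).trans ((one_le_div (by positivity)).2 (by linarith))

theorem rpow_le_mul_min_one_rpow (hd : 0 < d) (hdD : d ≤ D) (hΛ : 0 < Λ) (ht : Λ⁻¹ ≤ t)
    (htΛ : t ≤ Λ) : d ^ t ≤ (1 + 2 * D) ^ Λ * min 1 d ^ Λ⁻¹ := by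
  have hD : 1 ≤ 1 + 2 * D := by linarith
  rcases le_total d 1 with hd₁ | hd₁
  · rw [min_eq_right hd₁]
    exact (Real.rpow_le_rpow_of_exponent_ge hd hd₁ ht).trans
      (le_mul_of_one_le_left (by positivity) (Real.one_le_rpow hD hΛ.le))
  · rw [min_eq_left hd₁, Real.one_rpow, mul_one]
    exact (Real.rpow_le_rpow_of_exponent_le hd₁ htΛ).trans
      (Real.rpow_le_rpow hd.le (by linarith) hΛ.le)

theorem rpow_le_dyadicWeight (hΛ : 0 < Λ) (hd : 0 < d) (hdδ : d ≤ 2 * δ)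
    (hkd : (2 : ℝ) ^ (-k - 1) ≤ d) (hdk : d < (2 : ℝ) ^ (-k)) (ht : Λ⁻¹ ≤ t) (htΛ : t ≤ Λ) :
    d ^ t ≤ dyadicWeight Λ δ k := by
  have hδ : 0 < 1 + 2 * (2 * δ) := by linarith
  calc d ^ t ≤ (1 + 2 * (2 * δ)) ^ Λ * min 1 d ^ Λ⁻¹ := rpow_le_mul_min_one_rpow hd hdδ hΛ ht htΛ
    _ ≤ (1 + 2 * (2 * δ)) ^ Λ * ((1 + 2 * (2 * δ)) * 2⁻¹ ^ k.natAbs) ^ Λ⁻¹ := by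
        gcongr
        exact min_one_le_mul_inv_two_pow hd hdδ hkd hdk
    _ = dyadicWeight Λ δ k := by
        rw [dyadicWeight, Real.mul_rpow hδ.le (by positivity), Real.rpow_add hδ, mul_assoc]

theorem dyadicWeight_nonneg (hδ : 0 < δ) : 0 ≤ dyadicWeight Λ δ k := by
  unfold dyadicWeight
  positivity

theorem dyadicWeightBound_nonneg (hδ : 0 < δ) : 0 ≤ dyadicWeightBound Λ δ k := by
  unfold dyadicWeightBound
  positivity

theorem dyadicWeight_rpow_le (hΛ : 0 < Λ) (hδ : 0 < δ) (ht : Λ⁻¹ ≤ t) (htΛ : t ≤ Λ) :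
    dyadicWeight Λ δ k ^ t ≤ dyadicWeightBound Λ δ k := by
  have hΛ' : 0 < Λ⁻¹ := inv_pos.2 hΛ
  have hone : 1 ≤ (1 + 2 * (2 * δ)) ^ (Λ + Λ⁻¹) := Real.one_le_rpow (by linarith) (by positivity)
  have hdecay : (((2⁻¹ : ℝ) ^ k.natAbs) ^ Λ⁻¹) ^ t ≤ ((2⁻¹ : ℝ) ^ (Λ⁻¹ * Λ⁻¹)) ^ k.natAbs :=
    calc (((2⁻¹ : ℝ) ^ k.natAbs) ^ Λ⁻¹) ^ t ≤ (((2⁻¹ : ℝ) ^ k.natAbs) ^ Λ⁻¹) ^ Λ⁻¹ :=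
          Real.rpow_le_rpow_of_exponent_ge (by positivity)
            (Real.rpow_le_one (by positivity) (pow_le_one₀ (by norm_num) (by norm_num)) hΛ'.le) ht
      _ = ((2⁻¹ : ℝ) ^ (Λ⁻¹ * Λ⁻¹)) ^ k.natAbs := by
          rw [← Real.rpow_mul (by positivity), ← Real.rpow_natCast_mul (by norm_num), mul_comm,
            Real.rpow_mul_natCast (by norm_num)]
  rw [dyadicWeight, Real.mul_rpow (zero_le_one.trans hone) (by positivity)]
  exact mul_le_mul (Real.rpow_le_rpow_of_exponent_le hone htΛ) hdecay (by positivity)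
    (by positivity)

theorem summable_dyadicWeightBound (hΛ : 0 < Λ) : Summable (dyadicWeightBound Λ δ) := by
  have hgeom : Summable fun n : ℕ => ((2⁻¹ : ℝ) ^ (Λ⁻¹ * Λ⁻¹)) ^ n :=
    summable_geometric_of_lt_one (by positivity)
      (Real.rpow_lt_one (by norm_num) (by norm_num) (by positivity))
  refine Summable.mul_left _ (Summable.of_nat_of_neg ?_ ?_) <;>
    simpa only [Int.natAbs_neg, Int.natAbs_natCast] using hgeom

end Weights

section Majorant

variable {X : Type*} {Λ δ b : ℝ} {p : X → ℝ} {f : ℤ → X → ℝ≥0∞} {x : X}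

/-- The sum of the `p(x)`-th powers of the terms of `f`, weighted by `dyadicWeight`. -/
noncomputable def weightedPowerSum (Λ δ : ℝ) (p : X → ℝ) (f : ℤ → X → ℝ≥0∞) (x : X) : ℝ≥0∞ :=
  ∑' k, (ENNReal.ofReal (dyadicWeight Λ δ k) * f k x) ^ p x

/-- A single function majorizing all weighted terms of the sequence `f` where the sum of their
`p(x)`-th powers is finite. -/
noncomputable def gradientMajorant (Λ δ : ℝ) (p : X → ℝ) (f : ℤ → X → ℝ≥0∞) (x : X) : ℝ :=
  (weightedPowerSum Λ δ p f x).toReal ^ (1 / p x)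

/-- A bound for `∫ gradientMajorant ^ p` when all terms of the sequence have modular at most `1`. -/
noncomputable def majorantMass (Λ δ : ℝ) : ℝ := ∑' k, dyadicWeightBound Λ δ k

/-- The constant `A` of the Hajłasz pairs arising from vector gradients. -/
noncomputable def gradientConst (b δ Λ : ℝ) : ℝ := 1 + majorantMass Λ δ + majorantMass Λ δ / b

theorem majorantMass_nonneg (hδ : 0 < δ) : 0 ≤ majorantMass Λ δ :=
  tsum_nonneg fun _ => dyadicWeightBound_nonneg hδ

theorem one_le_gradientConst (hb : 0 < b) (hδ : 0 < δ) : 1 ≤ gradientConst b δ Λ := by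
  have hmass : 0 ≤ majorantMass Λ δ := majorantMass_nonneg hδ
  have hdiv : 0 ≤ majorantMass Λ δ / b := by positivity
  unfold gradientConst
  linarith

theorem majorantMass_le_gradientConst (hb : 0 < b) (hδ : 0 < δ) :
    majorantMass Λ δ ≤ gradientConst b δ Λ := by
  have hdiv : 0 ≤ majorantMass Λ δ / b := div_nonneg (majorantMass_nonneg hδ) hb.le
  unfold gradientConst
  linarith

theorem majorantMass_div_le_gradientConst (hδ : 0 < δ) :
    majorantMass Λ δ / b ≤ gradientConst b δ Λ := by
  have hmass : 0 ≤ majorantMass Λ δ := majorantMass_nonneg hδ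
  unfold gradientConst
  linarith

theorem gradientMajorant_nonneg (x : X) : 0 ≤ gradientMajorant Λ δ p f x :=
  Real.rpow_nonneg ENNReal.toReal_nonneg _

theorem gradientMajorant_rpow (hp : 0 < p x) :
    gradientMajorant Λ δ p f x ^ p x = (weightedPowerSum Λ δ p f x).toReal := by
  rw [gradientMajorant, ← Real.rpow_mul ENNReal.toReal_nonneg, one_div_mul_cancel hp.ne',
    Real.rpow_one]

theorem dyadicWeight_mul_le_gradientMajorant (hp : 0 < p x)
    (hfin : weightedPowerSum Λ δ p f x < ∞) (k : ℤ) :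
    ENNReal.ofReal (dyadicWeight Λ δ k) * f k x ≤ ENNReal.ofReal (gradientMajorant Λ δ p f x) := by
  rw [← ENNReal.rpow_le_rpow_iff hp,
    ENNReal.ofReal_rpow_of_nonneg (gradientMajorant_nonneg x) hp.le, gradientMajorant_rpow hp,
    ENNReal.ofReal_toReal hfin.ne]
  exact ENNReal.le_tsum (f := fun k => (ENNReal.ofReal (dyadicWeight Λ δ k) * f k x) ^ p x) k

theorem rpow_mul_le_rpow_mul_gradientMajorant (hΛ : 0 < Λ) (hp : 0 < p x)
    (hfin : weightedPowerSum Λ δ p f x < ∞) {d s ε : ℝ} {k : ℤ} (hd : 0 < d) (hdδ : d ≤ 2 * δ)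
    (hkd : (2 : ℝ) ^ (-k - 1) ≤ d) (hdk : d < (2 : ℝ) ^ (-k)) (hgap : Λ⁻¹ ≤ s - ε)
    (hgapΛ : s - ε ≤ Λ) :
    ENNReal.ofReal (d ^ s) * f k x ≤ ENNReal.ofReal (d ^ ε * gradientMajorant Λ δ p f x) := by
  have hpow : d ^ s ≤ d ^ ε * dyadicWeight Λ δ k := by
    rw [← add_sub_cancel ε s, Real.rpow_add hd]
    gcongr
    exact rpow_le_dyadicWeight hΛ hd hdδ hkd hdk hgap hgapΛ
  calc ENNReal.ofReal (d ^ s) * f k x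
      ≤ ENNReal.ofReal (d ^ ε * dyadicWeight Λ δ k) * f k x := by gcongr
    _ = ENNReal.ofReal (d ^ ε) * (ENNReal.ofReal (dyadicWeight Λ δ k) * f k x) := by
        rw [ENNReal.ofReal_mul (by positivity), mul_assoc]
    _ ≤ ENNReal.ofReal (d ^ ε) * ENNReal.ofReal (gradientMajorant Λ δ p f x) := by
        gcongr
        exact dyadicWeight_mul_le_gradientMajorant hp hfin k
    _ = ENNReal.ofReal (d ^ ε * gradientMajorant Λ δ p f x) :=
        (ENNReal.ofReal_mul (by positivity)).symm

variable [MeasurableSpace X] {μ : Measure X} {E : Set X}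

theorem aemeasurable_weightedPowerSum (hp : AEMeasurable p (μ.restrict E))
    (hf : ∀ k, AEMeasurable (f k) (μ.restrict E)) :
    AEMeasurable (weightedPowerSum Λ δ p f) (μ.restrict E) :=
  AEMeasurable.tsum fun k => ((hf k).const_mul _).pow hp

theorem lintegral_weightedPowerSum_le (hΛ : 0 < Λ) (hδ : 0 < δ) (hpΛ : ∀ x, Λ⁻¹ ≤ p x ∧ p x ≤ Λ)
    (hp : AEMeasurable p (μ.restrict E)) (hf : ∀ k, AEMeasurable (f k) (μ.restrict E))
    (hmod : ∀ k, modular μ E p (f k) ≤ 1) :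
    ∫⁻ x in E, weightedPowerSum Λ δ p f x ∂μ ≤ ENNReal.ofReal (majorantMass Λ δ) := by
  unfold weightedPowerSum
  rw [lintegral_tsum fun k => ((hf k).const_mul _).pow hp, majorantMass,
    ENNReal.ofReal_tsum_of_nonneg (fun _ => dyadicWeightBound_nonneg hδ)
      (summable_dyadicWeightBound hΛ)]
  refine ENNReal.tsum_le_tsum fun k => ?_
  calc ∫⁻ x in E, (ENNReal.ofReal (dyadicWeight Λ δ k) * f k x) ^ p x ∂μ
      ≤ ∫⁻ x in E, ENNReal.ofReal (dyadicWeightBound Λ δ k) * f k x ^ p x ∂μ := by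
        refine lintegral_mono fun x => ?_
        have hpx : 0 ≤ p x := (inv_pos.2 hΛ).le.trans (hpΛ x).1
        rw [ENNReal.mul_rpow_of_nonneg _ _ hpx,
          ENNReal.ofReal_rpow_of_nonneg (dyadicWeight_nonneg hδ) hpx]
        gcongr
        exact dyadicWeight_rpow_le hΛ hδ (hpΛ x).1 (hpΛ x).2
    _ = ENNReal.ofReal (dyadicWeightBound Λ δ k) * modular μ E p (f k) :=
        lintegral_const_mul' _ _ ENNReal.ofReal_ne_top
    _ ≤ ENNReal.ofReal (dyadicWeightBound Λ δ k) := mul_le_of_le_one_right' (hmod k)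

theorem exists_mem_le_lintegral_div {B : Set X} (hB : MeasurableSet B) (hB₀ : μ B ≠ 0)
    (hB_top : μ B ≠ ∞) {F : X → ℝ≥0∞} (hF : AEMeasurable F (μ.restrict B)) {P : X → Prop}
    (hP : ∀ᵐ z ∂μ.restrict B, P z) : ∃ z ∈ B, P z ∧ F z ≤ (∫⁻ x in B, F x ∂μ) / μ B := by
  have : IsFiniteMeasure (μ.restrict B) := isFiniteMeasure_restrict.2 hB_top
  have hnull : μ.restrict B {z | ¬(z ∈ B ∧ P z)} = 0 := (ae_restrict_mem hB).and hP
  obtain ⟨z, hz, hFz⟩ := exists_notMem_null_le_laverage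
    (by simpa only [ne_eq, Measure.restrict_eq_zero] using hB₀) hF hnull
  rw [setLAverage_eq] at hFz
  obtain ⟨hzB, hzP⟩ := not_not.1 hz
  exact ⟨z, hzB, hzP, hFz⟩

end Majorant

section GoodPoints

variable {X : Type*} [MetricSpace X] {δ Λ a : ℝ} {Q p ε s : X → ℝ} {E N : Set X} {u : X → EReal}
  {g : ℤ → X → ℝ≥0∞}

/-- The points of `E` at which all hypotheses holding almost everywhere are satisfied: outside the
exceptional set `N` of the vector gradient, with a finite gradient majorant of `g / (2 * a)`, a
finite value of `u`, and admissible exponents. -/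
def goodPoints (Λ δ a : ℝ) (p ε s : X → ℝ) (E N : Set X) (u : X → EReal) (g : ℤ → X → ℝ≥0∞) :
    Set X :=
  {x | x ∈ E ∧ x ∉ N ∧ weightedPowerSum Λ δ p (fun k x => g k x / ENNReal.ofReal (2 * a)) x < ∞ ∧
    (u x ≠ ⊤ ∧ u x ≠ ⊥) ∧ Λ⁻¹ ≤ s x - ε x ∧ s x ≤ Λ}

theorem rpow_mul_le_of_mem_goodPoints (hexp : RegularExponents Λ Q p ε) (ha : 0 < a)
    {x : X} (hx : x ∈ goodPoints Λ δ a p ε s E N u g) {d : ℝ} {k : ℤ} (hd : 0 < d)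
    (hdδ : d ≤ 2 * δ) (hkd : (2 : ℝ) ^ (-k - 1) ≤ d) (hdk : d < (2 : ℝ) ^ (-k)) :
    ENNReal.ofReal (d ^ s x) * g k x ≤ ENNReal.ofReal (2 * a * (d ^ ε x *
      gradientMajorant Λ δ p (fun k x => g k x / ENNReal.ofReal (2 * a)) x)) := by
  obtain ⟨-, -, hfin, -, hgap, hsΛ⟩ := hx
  have hle := rpow_mul_le_rpow_mul_gradientMajorant hexp.pos (hexp.p_pos x) hfin hd hdδ hkd hdk hgap
    (by linarith [hexp.ε_pos x])
  have h2a : 0 < 2 * a := by positivity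
  calc ENNReal.ofReal (d ^ s x) * g k x
      = ENNReal.ofReal (2 * a) * (ENNReal.ofReal (d ^ s x) * (g k x / ENNReal.ofReal (2 * a))) := by
        rw [mul_left_comm, ENNReal.mul_div_cancel (ENNReal.ofReal_pos.2 h2a).ne'
          ENNReal.ofReal_ne_top]
    _ ≤ _ := by
        rw [ENNReal.ofReal_mul h2a.le]
        gcongr

theorem abs_sub_le_of_mem_goodPoints (hexp : RegularExponents Λ Q p ε) (ha : 0 < a)
    (hE : ∀ x ∈ E, ∀ y ∈ E, dist x y ≤ 2 * δ)
    (hN : ∀ k : ℤ, ∀ x ∈ E \ N, ∀ y ∈ E \ N, (2 : ℝ) ^ (-k - 1) ≤ dist x y →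
      dist x y < (2 : ℝ) ^ (-k) → (u x - u y).abs ≤
        ENNReal.ofReal (dist x y ^ s x) * g k x + ENNReal.ofReal (dist x y ^ s y) * g k y)
    {x y : X} (hx : x ∈ goodPoints Λ δ a p ε s E N u g)
    (hy : y ∈ goodPoints Λ δ a p ε s E N u g) :
    |(u x).toReal / (2 * a) - (u y).toReal / (2 * a)| ≤
      dist x y ^ ε x * gradientMajorant Λ δ p (fun k x => g k x / ENNReal.ofReal (2 * a)) x +
      dist x y ^ ε y * gradientMajorant Λ δ p (fun k x => g k x / ENNReal.ofReal (2 * a)) y := by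
  set H := gradientMajorant Λ δ p fun k x => g k x / ENNReal.ofReal (2 * a)
  have hH (z : X) : 0 ≤ dist x y ^ ε z * H z :=
    mul_nonneg (by positivity) (gradientMajorant_nonneg z)
  rcases eq_or_ne x y with rfl | hne
  · rw [sub_self, abs_zero]
    exact add_nonneg (hH x) (hH x)
  have hd : 0 < dist x y := dist_pos.2 hne
  obtain ⟨n, hnd, hdn⟩ := exists_mem_Ico_zpow hd one_lt_two
  obtain ⟨k, rfl⟩ : ∃ k : ℤ, n = -k - 1 := ⟨-n - 1, by ring⟩
  rw [sub_add_cancel] at hdn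
  have hdδ := hE x hx.1 y hy.1
  have habs := (hN k x ⟨hx.1, hx.2.1⟩ y ⟨hy.1, hy.2.1⟩ hnd hdn).trans
    (add_le_add (rpow_mul_le_of_mem_goodPoints hexp ha hx hd hdδ hnd hdn)
      (rpow_mul_le_of_mem_goodPoints hexp ha hy hd hdδ hnd hdn))
  obtain ⟨-, -, -, ⟨hux, hux'⟩, -⟩ := hx
  obtain ⟨-, -, -, ⟨huy, huy'⟩, -⟩ := hy
  have h2a : 0 < 2 * a := by positivity
  have hHa (z : X) : 0 ≤ 2 * a * (dist x y ^ ε z * H z) := mul_nonneg h2a.le (hH z)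
  rw [← EReal.coe_toReal hux hux', ← EReal.coe_toReal huy huy', ← EReal.coe_sub, EReal.abs_def,
    ← ENNReal.ofReal_add (hHa x) (hHa y),
    ENNReal.ofReal_le_ofReal_iff (add_nonneg (hHa x) (hHa y))] at habs
  rwa [← sub_div, abs_div, abs_of_pos h2a, div_le_iff₀' h2a, mul_add]

end GoodPoints

section LocalData

variable {X : Type*} [MetricSpace X] [MeasurableSpace X] {μ : Measure X} {b δ σ Λ r₀ a : ℝ}
  {Q p ε s : X → ℝ} {x₀ : X} {q : X → ℝ≥0∞} {u : X → EReal} {g : ℤ → X → ℝ≥0∞}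

theorem LocalData.mul_radius_le (hloc : LocalData δ σ μ p s x₀ r₀ q u g) (hσ : 1 < σ) :
    σ * r₀ ≤ δ :=
  (le_div_iff₀' (zero_lt_one.trans hσ)).1 hloc.radius_le

theorem LocalData.radius_lt_mul (hloc : LocalData δ σ μ p s x₀ r₀ q u g) (hσ : 1 < σ) :
    r₀ < σ * r₀ :=
  lt_mul_of_one_lt_left hloc.radius_pos hσ

theorem LocalData.radius_le_delta (hloc : LocalData δ σ μ p s x₀ r₀ q u g) (hσ : 1 < σ) : r₀ ≤ δ :=
  (hloc.radius_lt_mul hσ).le.trans (hloc.mul_radius_le hσ)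

theorem LocalData.sub_one_mul_radius_le (hloc : LocalData δ σ μ p s x₀ r₀ q u g) (hσ : 1 < σ) :
    (σ - 1) * r₀ ≤ δ := by
  linarith [hloc.mul_radius_le hσ, hloc.radius_pos]

theorem LocalData.delta_pos (hloc : LocalData δ σ μ p s x₀ r₀ q u g) (hσ : 1 < σ) : 0 < δ :=
  hloc.radius_pos.trans_le (hloc.radius_le_delta hσ)

theorem LocalData.restrict_ball_le (hloc : LocalData δ σ μ p s x₀ r₀ q u g) (hσ : 1 < σ) :
    μ.restrict (Metric.ball x₀ r₀) ≤ μ.restrict (Metric.ball x₀ (σ * r₀)) :=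
  Measure.restrict_mono (Metric.ball_subset_ball (hloc.radius_lt_mul hσ).le) le_rfl

variable [OpensMeasurableSpace X]

theorem LocalData.ae_mem_goodPoints (hset : Setting b δ Λ μ Q p ε s)
    (hloc : LocalData δ σ μ p s x₀ r₀ q u g) {N : Set X} (hN : μ N = 0)
    (hfin : ∀ᵐ x ∂μ.restrict (Metric.ball x₀ (σ * r₀)),
      weightedPowerSum Λ δ p (fun k x => g k x / ENNReal.ofReal (2 * a)) x < ∞) :
    ∀ᵐ x ∂μ.restrict (Metric.ball x₀ (σ * r₀)),
      x ∈ goodPoints Λ δ a p ε s (Metric.ball x₀ (σ * r₀)) N u g := by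
  filter_upwards [ae_restrict_mem measurableSet_ball, hfin, hloc.u_mem.ae_finite,
    ae_restrict_of_ae (measure_eq_zero_iff_ae_notMem.1 hN),
    ae_restrict_of_ae hset.controlled.gap, ae_restrict_of_ae hset.controlled.bounds_s]
    with x hxE hxF hxu hxN hxgap hxs
  exact ⟨hxE, hxN, hxF, hxu, hxgap, hxs.2⟩

theorem exists_mem_rpow_gradientMajorant_le (hset : Setting b δ Λ μ Q p ε s) (hb : 0 < b)
    (hδ : 0 < δ) {f : ℤ → X → ℝ≥0∞} {E S : Set X}
    (hmeas : AEMeasurable (weightedPowerSum Λ δ p f) (μ.restrict E))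
    (hint : ∫⁻ x in E, weightedPowerSum Λ δ p f x ∂μ ≤ ENNReal.ofReal (majorantMass Λ δ))
    (hS : ∀ᵐ x ∂μ.restrict E, x ∈ S) {x : X} {R : ℝ} (hR : 0 < R) (hRδ : R ≤ δ)
    (hsub : Metric.ball x R ⊆ E) :
    ∃ z ∈ S, dist z x < R ∧
      gradientMajorant Λ δ p f z ^ p z ≤ gradientConst b δ Λ * R ^ (-Q x) := by
  have hball := hset.metricMeasure x R hR
  have hle : μ.restrict (Metric.ball x R) ≤ μ.restrict E := Measure.restrict_mono hsub le_rfl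
  obtain ⟨z, hzx, hzS, hz⟩ := exists_mem_le_lintegral_div measurableSet_ball hball.1.ne' hball.2.ne
    (hmeas.mono_measure hle) (hle.absolutelyContinuous.ae_le hS)
  have hbR : 0 < b * R ^ Q x := by positivity
  have hmass := majorantMass_nonneg (Λ := Λ) hδ
  refine ⟨z, hzS, hzx, ?_⟩
  rw [gradientMajorant_rpow (hset.p_mem.pos z)]
  calc (weightedPowerSum Λ δ p f z).toReal ≤ majorantMass Λ δ / (b * R ^ Q x) := by
        refine ENNReal.toReal_le_of_le_ofReal (by positivity) (hz.trans ?_)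
        rw [ENNReal.ofReal_div_of_pos hbR]
        exact ENNReal.div_le_div ((lintegral_mono_set hsub).trans hint)
          (hset.lowerRegular x R hR hRδ)
    _ = majorantMass Λ δ / b * R ^ (-Q x) := by
        rw [Real.rpow_neg hR.le, ← div_div, div_eq_mul_inv _ (R ^ Q x)]
    _ ≤ gradientConst b δ Λ * R ^ (-Q x) := by
        gcongr
        exact majorantMass_div_le_gradientConst hδ

theorem LocalData.exists_hajlaszPair (hset : Setting b δ Λ μ Q p ε s)
    (hloc : LocalData δ σ μ p s x₀ r₀ q u g) (hb : 0 < b) (hσ : 1 < σ) (hΛ : 0 < Λ)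
    (ha : mixedNorm μ (Metric.ball x₀ (σ * r₀)) p q g < ENNReal.ofReal a) :
    ∃ (S : Set X) (H : X → ℝ),
      HajlaszPair δ (gradientConst b δ Λ) Q p ε (Metric.ball x₀ (σ * r₀)) S
        (fun x => (u x).toReal / (2 * a)) H ∧
      (∀ᵐ x ∂μ.restrict (Metric.ball x₀ (σ * r₀)), x ∈ S) ∧
      ∫⁻ x in Metric.ball x₀ (σ * r₀), ENNReal.ofReal (H x ^ p x) ∂μ ≤
        ENNReal.ofReal (gradientConst b δ Λ) := by
  set E := Metric.ball x₀ (σ * r₀)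
  set f : ℤ → X → ℝ≥0∞ := fun k x => g k x / ENNReal.ofReal (2 * a)
  have hexp := hset.regularExponents hΛ x₀
  have hδ := hloc.delta_pos hσ
  have hp : AEMeasurable p (μ.restrict E) := hexp.continuous_p.aemeasurable
  have hf (k : ℤ) : AEMeasurable (f k) (μ.restrict E) :=
    (aemeasurable_restrict_of_measurable_subtype measurableSet_ball
      (hloc.g_grad.measurable k)).div_const _
  have hmeas := aemeasurable_weightedPowerSum (Λ := Λ) (δ := δ) hp hf
  have hint := lintegral_weightedPowerSum_le hΛ hδ (fun x => ⟨hexp.le_p x, hexp.p_le x⟩) hp hf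
    (modular_div_le_one_of_mixedNorm_lt (fun x => (hexp.p_pos x).le) hloc.q_mem ha)
  have hfin : ∀ᵐ x ∂μ.restrict E, weightedPowerSum Λ δ p f x < ∞ :=
    ae_lt_top' hmeas (hint.trans_lt ENNReal.ofReal_lt_top).ne
  obtain ⟨N, hN₀, hN⟩ := hloc.g_grad.ineq
  have hS := hloc.ae_mem_goodPoints hset hN₀ hfin
  have hdist : ∀ x ∈ E, ∀ y ∈ E, dist x y ≤ 2 * δ := fun x hx y hy => by
    linarith [dist_triangle_right x y x₀, Metric.mem_ball.1 hx, Metric.mem_ball.1 hy,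
      hloc.mul_radius_le hσ]
  refine ⟨goodPoints Λ δ a p ε s E N u g, gradientMajorant Λ δ p f,
    ⟨gradientMajorant_nonneg, fun x hx y hy => abs_sub_le_of_mem_goodPoints hexp
      (ENNReal.ofReal_pos.1 (bot_le.trans_lt ha)) hdist hN hx hy,
      fun x R hR hRδ => exists_mem_rpow_gradientMajorant_le hset hb hδ hmeas hint hS hR hRδ⟩,
    hS, ?_⟩
  calc ∫⁻ x in E, ENNReal.ofReal (gradientMajorant Λ δ p f x ^ p x) ∂μ
      ≤ ∫⁻ x in E, weightedPowerSum Λ δ p f x ∂μ := lintegral_mono fun x => by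
        rw [gradientMajorant_rpow (hexp.p_pos x)]
        exact ENNReal.ofReal_toReal_le
    _ ≤ ENNReal.ofReal (gradientConst b δ Λ) :=
        hint.trans (ENNReal.ofReal_le_ofReal (majorantMass_le_gradientConst hb hδ))

end LocalData

theorem lintegral_ofReal_le_of_ae_le_add_mul {X : Type*} [MeasurableSpace X]
    {ν : Measure X} [IsFiniteMeasure ν] {F G : X → ℝ}
    {c₁ c₂ A : ℝ} (hc₁ : 0 ≤ c₁) (hc₂ : 0 ≤ c₂) (hA : 0 ≤ A)
    (hF : ∀ᵐ x ∂ν, F x ≤ c₁ + c₂ * G x)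
    (hG : ∫⁻ x, ENNReal.ofReal (G x) ∂ν ≤ ENNReal.ofReal A) :
    ∫⁻ x, ENNReal.ofReal (F x) ∂ν ≤ ENNReal.ofReal (c₁ * ν.real Set.univ + c₂ * A) :=
  calc ∫⁻ x, ENNReal.ofReal (F x) ∂ν
      ≤ ∫⁻ x, (ENNReal.ofReal c₁ + ENNReal.ofReal c₂ * ENNReal.ofReal (G x)) ∂ν := by
        refine lintegral_mono_ae (hF.mono fun x hx => ?_)
        rw [← ENNReal.ofReal_mul hc₂]
        exact (ENNReal.ofReal_le_ofReal hx).trans ENNReal.ofReal_add_le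
    _ = ENNReal.ofReal c₁ * ν Set.univ + ENNReal.ofReal c₂ * ∫⁻ x, ENNReal.ofReal (G x) ∂ν := by
        rw [lintegral_add_left measurable_const, lintegral_const,
          lintegral_const_mul' _ _ ENNReal.ofReal_ne_top]
    _ ≤ ENNReal.ofReal c₁ * ENNReal.ofReal (ν.real Set.univ) +
          ENNReal.ofReal c₂ * ENNReal.ofReal A := by
        rw [ofReal_measureReal]
        gcongr
    _ = ENNReal.ofReal (c₁ * ν.real Set.univ + c₂ * A) := by
        rw [← ENNReal.ofReal_mul hc₁, ← ENNReal.ofReal_mul hc₂,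
          ← ENNReal.ofReal_add (by positivity) (by positivity)]

theorem le_mul_of_forall_lt_ofReal {c m n : ℝ≥0∞} (hc : c ≠ 0) (hc' : c ≠ ∞)
    (h : ∀ a : ℝ, n < ENNReal.ofReal a → m ≤ c * ENNReal.ofReal a) : m ≤ c * n := by
  by_contra! hlt
  rw [mul_comm, ← ENNReal.lt_div_iff_mul_lt (.inl hc) (.inl hc')] at hlt
  obtain ⟨a, -, hna, ham⟩ := ENNReal.lt_iff_exists_real_btwn.1 hlt
  rw [ENNReal.lt_div_iff_mul_lt (.inl hc) (.inl hc'), mul_comm] at ham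
  exact (h a hna).not_gt ham

theorem absSub_eq_ofReal {X : Type*} {u : X → EReal} {x : X}
    (hx : u x = ((u x).toReal : EReal)) (c : ℝ) :
    absSub u c x = ENNReal.ofReal |(u x).toReal - c| := by
  rw [absSub, hx, ← EReal.coe_sub, EReal.abs_def, EReal.toReal_coe]

section LocalEstimates

variable {X : Type*} [MetricSpace X] [MeasurableSpace X] {μ : Measure X}
  {b δ σ Λ r₀ a : ℝ} {Q p ε s : X → ℝ} {x₀ : X} {q : X → ℝ≥0∞} {u : X → EReal} {g : ℤ → X → ℝ≥0∞}

theorem IsMetricMeasure.isFiniteMeasure_restrict_ball (h : IsMetricMeasure μ) {r : ℝ}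
    (hr : 0 < r) (x : X) : IsFiniteMeasure (μ.restrict (Metric.ball x r)) :=
  isFiniteMeasure_restrict.2 (h x r hr).2.ne

theorem IsMetricMeasure.restrict_ball_neZero (h : IsMetricMeasure μ) {r : ℝ}
    (hr : 0 < r) (x : X) : NeZero (μ.restrict (Metric.ball x r)) :=
  ⟨fun h₀ => (h x r hr).1.ne' (Measure.restrict_eq_zero.1 h₀)⟩

theorem EssGap.forall_le {κ : ℝ} {f₁ f₂ : X → ℝ} (h : EssGap μ κ f₁ f₂) (hμ : IsMetricMeasure μ)
    (hf₁ : Continuous f₁) (hf₂ : Continuous f₂) (x : X) : κ ≤ f₂ x - f₁ x :=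
  have := hμ.isOpenPosMeasure
  forall_le_of_ae_le continuous_const (hf₂.sub hf₁) h x

theorem Setting.le_measureReal_ball_div (h : Setting b δ Λ μ Q p ε s) {r : ℝ} (hr : 0 < r)
    (hrδ : r ≤ δ) (x : X) : b ≤ μ.real (Metric.ball x r) / r ^ Q x :=
  (le_div_iff₀ (Real.rpow_pos_of_pos hr _)).2 <|
    (ENNReal.ofReal_le_iff_le_toReal (h.metricMeasure x r hr).2.ne).1 (h.lowerRegular x r hr hrδ)

theorem LocalData.ae_absSub_eq (hloc : LocalData δ σ μ p s x₀ r₀ q u g) (hσ : 1 < σ) (c : ℝ) :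
    ∀ᵐ x ∂μ.restrict (Metric.ball x₀ r₀), absSub u c x = ENNReal.ofReal |(u x).toReal - c| := by
  filter_upwards [ae_mono (hloc.restrict_ball_le hσ) hloc.u_mem.ae_finite] with x hx
  exact absSub_eq_ofReal (EReal.coe_toReal hx.1 hx.2).symm c

end LocalEstimates

section Sobolev

variable {X : Type*} [MeasurableSpace X] {μ : Measure X} {E : Set X} {γ : X → ℝ}

theorem luxNorm_le_mul_rpow {f : X → ℝ≥0∞} {a V m : ℝ} (ha : 0 < a) (hV : 1 ≤ V) (hm : 0 < m)
    (hγ : ∀ᵐ x ∂μ.restrict E, m ≤ γ x)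
    (h : modular μ E γ (fun x => f x / ENNReal.ofReal a) ≤ ENNReal.ofReal V) :
    luxNorm μ E γ f ≤ ENNReal.ofReal (a * V ^ (1 / m)) := by
  have hV₀ : 0 < V := zero_lt_one.trans_le hV
  have hVm : 1 ≤ V ^ (1 / m) := Real.one_le_rpow hV (one_div_pos.2 hm).le
  refine iInf₂_le_of_le _ (by positivity) (iInf_le_of_le ?_ le_rfl)
  simp only [div_ofReal_mul _ ha]
  calc modular μ E γ (fun x => f x / ENNReal.ofReal a / ENNReal.ofReal (V ^ (1 / m)))
      ≤ ENNReal.ofReal ((V ^ (1 / m))⁻¹ ^ m) * ENNReal.ofReal V :=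
        (modular_div_le hm.le hγ _ hVm).trans (by gcongr)
    _ = 1 := by
        rw [Real.inv_rpow (by positivity), one_div, Real.rpow_inv_rpow hV₀.le hm.ne',
          ← ENNReal.ofReal_mul (by positivity), inv_mul_cancel₀ hV₀.ne', ENNReal.ofReal_one]

/-- The bound for the modular of `u - c` in the Sobolev inequality, per unit of
`μ(B₀) / r₀ ^ Q(x₀)`. -/
noncomputable def sobolevModularConst (b δ σ Λ : ℝ) : ℝ :=
  2 ^ Λ ^ 3 * (radiusConst Λ δ σ + gradientConst b δ Λ / b) + 1 / b + 1

/-- The constant `C_S` of the Sobolev inequality. -/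
noncomputable def sobolevConst (b δ σ Λ : ℝ) : ℝ :=
  2 * sobolevChainConst Λ δ (gradientConst b δ Λ) σ * sobolevModularConst b δ σ Λ ^ Λ

variable {b δ σ Λ : ℝ}

theorem gradientConst_pos (hb : 0 < b) (hδ : 0 < δ) : 0 < gradientConst b δ Λ :=
  zero_lt_one.trans_le (one_le_gradientConst hb hδ)

theorem one_le_sobolevModularConst (hb : 0 < b) (hδ : 0 < δ) (hσ : 1 < σ) :
    1 ≤ sobolevModularConst b δ σ Λ := by
  have := radiusConst_pos (Λ := Λ) (δ := δ) hσ
  have := gradientConst_pos (Λ := Λ) hb hδ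
  exact le_add_of_nonneg_left (by positivity)

theorem one_le_sobolevModularConst_mul (hb : 0 < b) (hδ : 0 < δ) (hσ : 1 < σ) {M : ℝ}
    (hM : b ≤ M) : 1 ≤ sobolevModularConst b δ σ Λ * M := by
  have hK := radiusConst_pos (Λ := Λ) (δ := δ) hσ
  have hA := gradientConst_pos (Λ := Λ) hb hδ
  have hM₀ : 0 < M := hb.trans_le hM
  calc 1 ≤ 1 / b * M := by rwa [one_div_mul_eq_div, one_le_div hb]
    _ ≤ sobolevModularConst b δ σ Λ * M := by
        gcongr
        rw [sobolevModularConst, add_assoc]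
        exact le_add_of_nonneg_of_le (by positivity) (le_add_of_nonneg_right zero_le_one)

theorem le_sobolevModularConst_mul (hb : 0 < b) (hδ : 0 < δ) {M : ℝ} (hM : b ≤ M) :
    2 ^ Λ ^ 3 * (radiusConst Λ δ σ * M + gradientConst b δ Λ) ≤
      sobolevModularConst b δ σ Λ * M := by
  have hA := gradientConst_pos (Λ := Λ) hb hδ
  have hM₀ : 0 < M := hb.trans_le hM
  calc 2 ^ Λ ^ 3 * (radiusConst Λ δ σ * M + gradientConst b δ Λ)
      ≤ 2 ^ Λ ^ 3 * (radiusConst Λ δ σ * M + gradientConst b δ Λ * (M / b)) := by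
        gcongr
        exact le_mul_of_one_le_right hA.le ((one_le_div hb).2 hM)
    _ = sobolevModularConst b δ σ Λ * M - (1 / b + 1) * M := by
        rw [sobolevModularConst]
        ring
    _ ≤ sobolevModularConst b δ σ Λ * M := sub_le_self _ (by positivity)

theorem sobolevConst_pos (hb : 0 < b) (hδ : 0 < δ) (hσ : 1 < σ) (hΛ : 0 < Λ) :
    0 < sobolevConst b δ σ Λ := by
  have := one_le_sobolevModularConst (Λ := Λ) hb hδ hσ
  have := sobolevChainConst_pos (δ := δ) hΛ (gradientConst_pos (Λ := Λ) hb hδ) hσ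
  unfold sobolevConst
  positivity

theorem RegularExponents.inv_le_essInf_sobolevExp {X : Type*} [MetricSpace X] [MeasurableSpace X]
    {ν : Measure X} [NeZero ν] {Q p ε : X → ℝ} (hexp : RegularExponents Λ Q p ε)
    (hgap : ∀ x, Λ⁻¹ ≤ Q x - ε x * p x) : Λ⁻¹ ≤ essInf (sobolevExp Q p ε) ν :=
  le_essInf_of_ae_le _ (.of_forall fun x => hexp.le_sobolevExp (hgap x))
    (Filter.isBoundedUnder_of ⟨Λ ^ 3, fun x => hexp.sobolevExp_le (hgap x)⟩).isCoboundedUnder_ge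

theorem RegularExponents.ae_essInf_sobolevExp_le {X : Type*} [MetricSpace X] [MeasurableSpace X]
    {ν : Measure X} {Q p ε : X → ℝ} (hexp : RegularExponents Λ Q p ε)
    (hgap : ∀ x, Λ⁻¹ ≤ Q x - ε x * p x) :
    ∀ᵐ x ∂ν, essInf (sobolevExp Q p ε) ν ≤ sobolevExp Q p ε x :=
  ae_essInf_le (Filter.isBoundedUnder_of ⟨Λ⁻¹, fun x => hexp.le_sobolevExp (hgap x)⟩)

end Sobolev

section SobolevInequality

variable {X : Type*} [MetricSpace X] [MeasurableSpace X] {μ : Measure X}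
  {b δ σ Λ r₀ a : ℝ} {Q p ε s : X → ℝ} {x₀ : X} {q : X → ℝ≥0∞} {u : X → EReal} {g : ℤ → X → ℝ≥0∞}

theorem LocalData.modular_absSub_div_eq (hloc : LocalData δ σ μ p s x₀ r₀ q u g) (hσ : 1 < σ)
    {γ : X → ℝ} (hγ : ∀ x, 0 ≤ γ x) {t C : ℝ} (ht : 0 < t) (hC : 0 < C) (c : ℝ) :
    modular μ (Metric.ball x₀ r₀) γ (fun x => absSub u (t * c) x / ENNReal.ofReal (t * C)) =
      ∫⁻ x in Metric.ball x₀ r₀, ENNReal.ofReal ((|(u x).toReal / t - c| / C) ^ γ x) ∂μ := by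
  refine lintegral_congr_ae ((hloc.ae_absSub_eq hσ (t * c)).mono fun x hx => ?_)
  have hscale : |(u x).toReal - t * c| / (t * C) = |(u x).toReal / t - c| / C := by
    rw [div_mul_eq_div_div, div_sub' ht.ne', abs_div, abs_of_pos ht]
  simp only [hx]
  rw [← ENNReal.ofReal_div_of_pos (mul_pos ht hC), hscale,
    ENNReal.ofReal_rpow_of_nonneg (div_nonneg (abs_nonneg _) hC.le) (hγ x)]

variable [OpensMeasurableSpace X]

theorem LocalData.exists_modular_absSub_le (hset : Setting b δ Λ μ Q p ε s)
    (hgap : ∀ x, Λ⁻¹ ≤ Q x - ε x * p x) (hloc : LocalData δ σ μ p s x₀ r₀ q u g) (hb : 0 < b)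
    (hσ : 1 < σ) (hΛ : 0 < Λ)
    (ha : mixedNorm μ (Metric.ball x₀ (σ * r₀)) p q g < ENNReal.ofReal a) :
    ∃ c : ℝ, modular μ (Metric.ball x₀ r₀) (sobolevExp Q p ε) (fun x => absSub u c x /
        ENNReal.ofReal (2 * a * sobolevChainConst Λ δ (gradientConst b δ Λ) σ)) ≤
      ENNReal.ofReal (sobolevModularConst b δ σ Λ *
        (μ.real (Metric.ball x₀ r₀) / r₀ ^ Q x₀)) := by
  have hexp := hset.regularExponents hΛ x₀
  have hr₀ := hloc.radius_pos
  have ha₀ : 0 < a := ENNReal.ofReal_pos.1 (bot_le.trans_lt ha)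
  have hA := gradientConst_pos (Λ := Λ) hb (hloc.delta_pos hσ)
  have hK := radiusConst_pos (Λ := Λ) (δ := δ) hσ
  have hle := hloc.restrict_ball_le hσ
  have := hset.metricMeasure.isFiniteMeasure_restrict_ball hr₀ x₀
  obtain ⟨S, H, hpair, hS, hH⟩ := hloc.exists_hajlaszPair hset hb hσ hΛ ha
  obtain ⟨c, hc⟩ := hpair.exists_sobolev_rpow_bound hexp
    (one_le_gradientConst hb (hloc.delta_pos hσ)) hσ hr₀ (hloc.radius_le_delta hσ)
    (hloc.sub_one_mul_radius_le hσ) hgap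
  refine ⟨2 * a * c, ?_⟩
  rw [hloc.modular_absSub_div_eq hσ
    (fun x => (inv_pos.2 hΛ).le.trans (hexp.le_sobolevExp (hgap x))) (by positivity)
    (sobolevChainConst_pos hΛ hA hσ)]
  calc _ ≤ ENNReal.ofReal (2 ^ Λ ^ 3 * (radiusConst Λ δ σ * r₀ ^ (-Q x₀)) *
          (μ.restrict (Metric.ball x₀ r₀)).real Set.univ + 2 ^ Λ ^ 3 * gradientConst b δ Λ) := by
        refine lintegral_ofReal_le_of_ae_le_add_mul (G := fun x => H x ^ p x) (by positivity)
          (by positivity) hA.le ?_ ((lintegral_mono' hle le_rfl).trans hH)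
        filter_upwards [ae_mono hle hS, ae_restrict_mem measurableSet_ball] with x hxS hxB
        exact (hc x ⟨hxS, hxB⟩).trans_eq (mul_add _ _ _)
    _ = ENNReal.ofReal (2 ^ Λ ^ 3 * (radiusConst Λ δ σ *
          (μ.real (Metric.ball x₀ r₀) / r₀ ^ Q x₀) + gradientConst b δ Λ)) := by
        rw [measureReal_restrict_apply_univ, Real.rpow_neg hr₀.le]
        ring_nf
    _ ≤ _ := ENNReal.ofReal_le_ofReal (le_sobolevModularConst_mul hb (hloc.delta_pos hσ)
        (hset.le_measureReal_ball_div hr₀ (hloc.radius_le_delta hσ) x₀))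

theorem sobolev_inequality (hset : Setting b δ Λ μ Q p ε s)
    (hgap : EssGap μ Λ⁻¹ (fun x => ε x * p x) Q) (hloc : LocalData δ σ μ p s x₀ r₀ q u g)
    (hb : 0 < b) (hσ : 1 < σ) (hΛ : 0 < Λ) :
    ⨅ c : ℝ, luxNorm μ (Metric.ball x₀ r₀) (sobolevExp Q p ε) (absSub u c) ≤
      ENNReal.ofReal (sobolevConst b δ σ Λ * (μ.real (Metric.ball x₀ r₀) / r₀ ^ Q x₀) ^
        (1 / essInf (sobolevExp Q p ε) (μ.restrict (Metric.ball x₀ r₀)))) *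
      mixedNorm μ (Metric.ball x₀ (σ * r₀)) p q g := by
  have hexp := hset.regularExponents hΛ x₀
  have hδ := hloc.delta_pos hσ
  have hr₀ := hloc.radius_pos
  have hgap' := hgap.forall_le hset.metricMeasure (hexp.continuous_ε.mul hexp.continuous_p)
    hexp.continuous_Q
  have := hset.metricMeasure.restrict_ball_neZero hr₀ x₀
  have hbM := hset.le_measureReal_ball_div hr₀ (hloc.radius_le_delta hσ) x₀
  set M := μ.real (Metric.ball x₀ r₀) / r₀ ^ Q x₀
  have hM₀ : 0 < M := hb.trans_le hbM
  set C := sobolevChainConst Λ δ (gradientConst b δ Λ) σ with hC_def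
  have hC : 0 < C := sobolevChainConst_pos hΛ (gradientConst_pos hb hδ) hσ
  have hV₁ := one_le_sobolevModularConst (Λ := Λ) hb hδ hσ
  set V := sobolevModularConst b δ σ Λ with hV_def
  have hm := hexp.inv_le_essInf_sobolevExp (ν := μ.restrict (Metric.ball x₀ r₀)) hgap'
  have hγ := hexp.ae_essInf_sobolevExp_le (ν := μ.restrict (Metric.ball x₀ r₀)) hgap'
  set m := essInf (sobolevExp Q p ε) (μ.restrict (Metric.ball x₀ r₀))
  have hS := sobolevConst_pos hb hδ hσ hΛ
  refine le_mul_of_forall_lt_ofReal (ENNReal.ofReal_pos.2 (by positivity)).ne'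
    ENNReal.ofReal_ne_top fun a ha => ?_
  have ha₀ : 0 < a := ENNReal.ofReal_pos.1 (bot_le.trans_lt ha)
  obtain ⟨c, hc⟩ := hloc.exists_modular_absSub_le hset hgap' hb hσ hΛ ha
  refine iInf_le_of_le c ((luxNorm_le_mul_rpow (by positivity)
    (one_le_sobolevModularConst_mul hb hδ hσ hbM) ((inv_pos.2 hΛ).trans_le hm) hγ hc).trans ?_)
  rw [← ENNReal.ofReal_mul (by positivity), Real.mul_rpow (by positivity) hM₀.le]
  refine ENNReal.ofReal_le_ofReal ?_
  calc 2 * a * C * (V ^ (1 / m) * M ^ (1 / m)) ≤ 2 * a * C * (V ^ Λ * M ^ (1 / m)) := by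
        gcongr
        exact one_div m ▸ inv_le_of_inv_le₀ hΛ hm
    _ = sobolevConst b δ σ Λ * M ^ (1 / m) * a := by rw [sobolevConst, ← hC_def, ← hV_def]; ring

end SobolevInequality

section ExponentialMean

variable {X : Type*} [MeasurableSpace X] {ν : Measure X} {U : X → ℝ} {a c K : ℝ}

theorem integrable_exp_mul_abs_sub (hU : AEMeasurable U ν)
    (h : ∫⁻ x, ENNReal.ofReal (Real.exp (a * |U x - c|)) ∂ν < ∞) :
    Integrable (fun x => Real.exp (a * |U x - c|)) ν :=
  ⟨(Real.measurable_exp.comp_aemeasurable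
      ((hU.sub_const c).abs.const_mul a)).aestronglyMeasurable,
    (hasFiniteIntegral_iff_ofReal (.of_forall fun _ => (Real.exp_pos _).le)).2 h⟩

variable [IsFiniteMeasure ν]

theorem integrable_of_integrable_exp_mul_abs_sub (hU : AEMeasurable U ν) (ha : 0 < a)
    (h : Integrable (fun x => Real.exp (a * |U x - c|)) ν) : Integrable U ν := by
  have hsub : Integrable (fun x => U x - c) ν := by
    refine (h.const_mul a⁻¹).mono' (hU.sub_const c).aestronglyMeasurable (.of_forall fun x => ?_)
    rw [Real.norm_eq_abs, inv_mul_eq_div, le_div_iff₀' ha]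
    linarith [Real.add_one_le_exp (a * |U x - c|)]
  exact (hsub.add (integrable_const c)).congr (.of_forall fun x => sub_add_cancel (U x) c)

variable [NeZero ν]

theorem exp_mul_abs_average_sub_le (hU : Integrable U ν) (ha : 0 ≤ a)
    (h : Integrable (fun x => Real.exp (a * |U x - c|)) ν) :
    Real.exp (a * |(⨍ x, U x ∂ν) - c|) ≤ ⨍ x, Real.exp (a * |U x - c|) ∂ν := by
  have habs : ConvexOn ℝ Set.univ fun y : ℝ => a * |y - c| := by
    simpa only [Real.dist_eq, smul_eq_mul] using (convexOn_univ_dist c).smul ha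
  have himage : Convex ℝ ((fun y : ℝ => a * |y - c|) '' Set.univ) :=
    Real.convex_iff_isPreconnected.2 (isPreconnected_univ.image _ (by fun_prop))
  have hconv : ConvexOn ℝ Set.univ fun y : ℝ => Real.exp (a * |y - c|) :=
    (convexOn_exp.subset (Set.subset_univ _) himage).comp habs (Real.exp_monotone.monotoneOn _)
  exact hconv.map_average_le (by fun_prop) isClosed_univ (.of_forall fun _ => Set.mem_univ _) hU h

theorem laverage_exp_mul_abs_sub_average_le (hU : AEMeasurable U ν) (ha : 0 < a) (hK : 0 ≤ K)
    (h : ⨍⁻ x, ENNReal.ofReal (Real.exp (a * |U x - c|)) ∂ν ≤ ENNReal.ofReal K) :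
    Integrable U ν ∧
      ⨍⁻ x, ENNReal.ofReal (Real.exp (a * |U x - ⨍ y, U y ∂ν|)) ∂ν ≤ ENNReal.ofReal (K ^ 2) := by
  have hexp : Integrable (fun x => Real.exp (a * |U x - c|)) ν := by
    refine integrable_exp_mul_abs_sub hU ?_
    rw [← measure_mul_laverage]
    exact ENNReal.mul_lt_top (measure_lt_top _ _) (h.trans_lt ENNReal.ofReal_lt_top)
  have hint := integrable_of_integrable_exp_mul_abs_sub hU ha hexp
  refine ⟨hint, ?_⟩
  set m := ⨍ y, U y ∂ν
  have hm : Real.exp (a * |m - c|) ≤ K := by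
    refine (exp_mul_abs_average_sub_le hint ha.le hexp).trans ?_
    rw [← ENNReal.ofReal_le_ofReal_iff hK,
      ofReal_average hexp (.of_forall fun _ => (Real.exp_pos _).le)]
    rwa [laverage_eq] at h
  have hpoint (x : X) : ENNReal.ofReal (Real.exp (a * |U x - m|)) ≤
      ENNReal.ofReal K * ENNReal.ofReal (Real.exp (a * |U x - c|)) := by
    rw [← ENNReal.ofReal_mul hK]
    refine ENNReal.ofReal_le_ofReal ?_
    calc Real.exp (a * |U x - m|) ≤ Real.exp (a * |m - c| + a * |U x - c|) := by
          rw [← mul_add, Real.exp_le_exp]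
          gcongr
          linarith [abs_sub_le (U x) c m, abs_sub_comm c m]
      _ ≤ K * Real.exp (a * |U x - c|) := by
          rw [Real.exp_add]
          gcongr
  calc ⨍⁻ x, ENNReal.ofReal (Real.exp (a * |U x - m|)) ∂ν
      ≤ ENNReal.ofReal K * ⨍⁻ x, ENNReal.ofReal (Real.exp (a * |U x - c|)) ∂ν :=
        (lintegral_mono hpoint).trans_eq (lintegral_const_mul' _ _ ENNReal.ofReal_ne_top)
    _ ≤ ENNReal.ofReal (K ^ 2) := by
        rw [sq, ENNReal.ofReal_mul hK]
        gcongr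

end ExponentialMean

section MoserTrudinger

/-- The constant `C_MT1` of the Moser–Trudinger inequality. -/
noncomputable def moserTrudingerRate (b δ σ Λ : ℝ) : ℝ :=
  moserTrudingerChainRate Λ δ (gradientConst b δ Λ) σ / 4

/-- The bound for the exponential mean of `u` around a suitable constant; the Moser–Trudinger
inequality holds with `C_MT2` equal to its square. -/
noncomputable def moserTrudingerConst (b δ σ Λ : ℝ) : ℝ :=
  8 * (1 + radiusConst Λ δ σ * gradientConst b δ Λ / b)

theorem moserTrudingerRate_pos {b δ σ Λ : ℝ} (hb : 0 < b) (hδ : 0 < δ) (hσ : 1 < σ) (hΛ : 0 < Λ) :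
    0 < moserTrudingerRate b δ σ Λ :=
  div_pos (moserTrudingerChainRate_pos hΛ (gradientConst_pos hb hδ) hσ) four_pos

theorem moserTrudingerConst_pos {b δ σ Λ : ℝ} (hb : 0 < b) (hδ : 0 < δ) (hσ : 1 < σ) :
    0 < moserTrudingerConst b δ σ Λ := by
  have := radiusConst_pos (Λ := Λ) (δ := δ) hσ
  have := gradientConst_pos (Λ := Λ) hb hδ
  unfold moserTrudingerConst
  positivity

variable {X : Type*} [MetricSpace X] [MeasurableSpace X] [OpensMeasurableSpace X] {μ : Measure X}
  {b δ σ Λ r₀ a : ℝ} {Q p ε s : X → ℝ} {x₀ : X} {q : X → ℝ≥0∞} {u : X → EReal} {g : ℤ → X → ℝ≥0∞}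

theorem LocalData.aemeasurable_toReal (hloc : LocalData δ σ μ p s x₀ r₀ q u g) (hσ : 1 < σ) :
    AEMeasurable (fun x => (u x).toReal) (μ.restrict (Metric.ball x₀ r₀)) :=
  ((aemeasurable_restrict_of_measurable_subtype measurableSet_ball
    hloc.u_mem.measurable).mono_measure (hloc.restrict_ball_le hσ)).ereal_toReal

theorem LocalData.exists_laverage_exp_le (hset : Setting b δ Λ μ Q p ε s)
    (hQε : ∀ x, ε x * p x = Q x) (hloc : LocalData δ σ μ p s x₀ r₀ q u g) (hb : 0 < b)
    (hσ : 1 < σ) (hΛ : 0 < Λ)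
    (ha : mixedNorm μ (Metric.ball x₀ (σ * r₀)) p q g < ENNReal.ofReal a) :
    ∃ c : ℝ, ⨍⁻ x in Metric.ball x₀ r₀, ENNReal.ofReal (Real.exp
        (moserTrudingerChainRate Λ δ (gradientConst b δ Λ) σ / (2 * a) * |(u x).toReal - c|)) ∂μ ≤
      ENNReal.ofReal (moserTrudingerConst b δ σ Λ) := by
  have hr₀ := hloc.radius_pos
  have hδ := hloc.delta_pos hσ
  have ha₀ : 0 < 2 * a := mul_pos two_pos (ENNReal.ofReal_pos.1 (bot_le.trans_lt ha))
  have hA := gradientConst_pos (Λ := Λ) hb hδ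
  have hK := radiusConst_pos (Λ := Λ) (δ := δ) hσ
  have hle := hloc.restrict_ball_le hσ
  have hball := hset.metricMeasure x₀ r₀ hr₀
  have := hset.metricMeasure.isFiniteMeasure_restrict_ball hr₀ x₀
  obtain ⟨S, H, hpair, hS, hH⟩ := hloc.exists_hajlaszPair hset hb hσ hΛ ha
  obtain ⟨c, hc⟩ := hpair.exists_exponential_bound (hset.regularExponents hΛ x₀)
    (one_le_gradientConst hb hδ) hσ hr₀ (hloc.radius_le_delta hσ)
    (hloc.sub_one_mul_radius_le hσ) hQε
  refine ⟨2 * a * c, ?_⟩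
  have hscale (y : ℝ) : |y - 2 * a * c| / (2 * a) = |y / (2 * a) - c| := by
    rw [div_sub' ha₀.ne', abs_div, abs_of_pos ha₀]
  simp only [div_mul_eq_mul_div, mul_div_assoc, hscale]
  rw [setLAverage_eq]
  refine ENNReal.div_le_of_le_mul ?_
  rw [← ofReal_measureReal hball.2.ne, ← ENNReal.ofReal_mul (moserTrudingerConst_pos hb hδ hσ).le]
  calc _ ≤ ENNReal.ofReal (8 * (μ.restrict (Metric.ball x₀ r₀)).real Set.univ +
          8 * (radiusConst Λ δ σ * r₀ ^ Q x₀) * gradientConst b δ Λ) := by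
        refine lintegral_ofReal_le_of_ae_le_add_mul (G := fun x => H x ^ p x) (by positivity)
          (by positivity) hA.le ?_ ((lintegral_mono' hle le_rfl).trans hH)
        filter_upwards [ae_mono hle hS, ae_restrict_mem measurableSet_ball] with x hxS hxB
        exact (hc x ⟨hxS, hxB⟩).trans_eq (by ring)
    _ ≤ ENNReal.ofReal (8 * μ.real (Metric.ball x₀ r₀) + 8 * (radiusConst Λ δ σ *
          (μ.real (Metric.ball x₀ r₀) / b)) * gradientConst b δ Λ) := by
        rw [measureReal_restrict_apply_univ]
        gcongr
        rw [le_div_comm₀ (by positivity) hb]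
        exact hset.le_measureReal_ball_div hr₀ (hloc.radius_le_delta hσ) x₀
    _ = ENNReal.ofReal (moserTrudingerConst b δ σ Λ * μ.real (Metric.ball x₀ r₀)) := by
        rw [moserTrudingerConst]
        ring_nf

theorem moser_trudinger_inequality (hset : Setting b δ Λ μ Q p ε s)
    (hQε : ∀ x, ε x * p x = Q x) (hloc : LocalData δ σ μ p s x₀ r₀ q u g) (hb : 0 < b)
    (hσ : 1 < σ) (hΛ : 0 < Λ) (hg : 0 < mixedNorm μ (Metric.ball x₀ (σ * r₀)) p q g) :
    IntegrableOn (fun x => (u x).toReal) (Metric.ball x₀ r₀) μ ∧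
    ⨍⁻ x in Metric.ball x₀ r₀, ENNReal.ofReal (Real.exp (moserTrudingerRate b δ σ Λ *
        (|(u x).toReal - avg μ (Metric.ball x₀ r₀) u| /
          (mixedNorm μ (Metric.ball x₀ (σ * r₀)) p q g).toReal))) ∂μ ≤
      ENNReal.ofReal (moserTrudingerConst b δ σ Λ ^ 2) := by
  have hδ := hloc.delta_pos hσ
  have hfin := hloc.g_mem.mixedNorm_lt_top hΛ (hset.regularExponents hΛ x₀).le_p hloc.q_mem
  set n := (mixedNorm μ (Metric.ball x₀ (σ * r₀)) p q g).toReal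
  have hn : 0 < n := ENNReal.toReal_pos hg.ne' hfin.ne
  have hlt : mixedNorm μ (Metric.ball x₀ (σ * r₀)) p q g < ENNReal.ofReal (2 * n) :=
    (ENNReal.lt_ofReal_iff_toReal_lt hfin.ne).2 (lt_mul_of_one_lt_left hn one_lt_two)
  have := hset.metricMeasure.isFiniteMeasure_restrict_ball hloc.radius_pos x₀
  have := hset.metricMeasure.restrict_ball_neZero hloc.radius_pos x₀
  obtain ⟨c, hc⟩ := hloc.exists_laverage_exp_le hset hQε hb hσ hΛ hlt
  have hrate : 0 < moserTrudingerChainRate Λ δ (gradientConst b δ Λ) σ / (2 * (2 * n)) :=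
    div_pos (moserTrudingerChainRate_pos hΛ (gradientConst_pos hb hδ) hσ) (by positivity)
  have hscale (y : ℝ) : moserTrudingerChainRate Λ δ (gradientConst b δ Λ) σ / (2 * (2 * n)) * y =
      moserTrudingerRate b δ σ Λ * (y / n) := by
    rw [moserTrudingerRate]
    ring
  simpa only [hscale, avg, IntegrableOn] using
    laverage_exp_mul_abs_sub_average_le (hloc.aemeasurable_toReal hσ) hrate
      (moserTrudingerConst_pos hb hδ hσ).le hc

end MoserTrudinger

theorem exists_tendsto_nhdsWithin_of_uniformContinuousOn {X Y : Type*} [UniformSpace X]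
    [UniformSpace Y] [CompleteSpace Y] {f : X → Y} {S : Set X} (hf : UniformContinuousOn f S)
    {x : X} (hx : x ∈ closure S) : ∃ y, Filter.Tendsto f (nhdsWithin x S) (nhds y) := by
  have : (nhdsWithin x S).NeBot := mem_closure_iff_nhdsWithin_neBot.1 hx
  exact cauchy_map_iff_exists_tendsto.1
    ((cauchy_nhds.mono nhdsWithin_le_nhds).map_of_le hf inf_le_right)

section HolderExtension

variable {X Y : Type*} [MetricSpace X] [MetricSpace Y] {S : Set X} {α : X → ℝ} {f : X → Y}
  {κ L : ℝ}

theorem uniformContinuousOn_of_dist_le_mul_rpow (hκ : 0 < κ) (hκα : ∀ x ∈ S, κ ≤ α x)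
    (hf : ∀ x ∈ S, ∀ y ∈ S, dist (f x) (f y) ≤ L * dist x y ^ α x) : UniformContinuousOn f S := by
  have hmodulus : Filter.Tendsto (fun r : ℝ => |L| * r ^ κ) (nhds 0) (nhds 0) := by
    have hcont : Continuous fun r : ℝ => |L| * r ^ κ :=
      continuous_const.mul (Real.continuous_rpow_const hκ.le)
    simpa only [Real.zero_rpow hκ.ne', mul_zero] using hcont.tendsto 0
  refine Metric.uniformContinuousOn_iff.2 fun η hη => ?_
  obtain ⟨r, hr, hsmall⟩ := Metric.eventually_nhds_iff.1 (hmodulus.eventually_lt_const hη)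
  refine ⟨min r 1, lt_min hr one_pos, fun x hx y hy hxy => ?_⟩
  rcases eq_or_ne x y with rfl | hne
  · rwa [dist_self]
  calc dist (f x) (f y) ≤ L * dist x y ^ α x := hf x hx y hy
    _ ≤ |L| * dist x y ^ α x := by
        gcongr
        exact le_abs_self L
    _ ≤ |L| * dist x y ^ κ := mul_le_mul_of_nonneg_left
        (Real.rpow_le_rpow_of_exponent_ge (dist_pos.2 hne) (hxy.le.trans (min_le_right _ _))
          (hκα x hx)) (abs_nonneg L)
    _ < η := hsmall (by
        rw [Real.dist_0_eq_abs, abs_of_nonneg dist_nonneg]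
        exact hxy.trans_le (min_le_left _ _))

theorem dist_le_mul_rpow_of_tendsto (hα : Continuous α)
    (hf : ∀ x ∈ S, ∀ y ∈ S, dist (f x) (f y) ≤ L * dist x y ^ α x) {x y : X} (hxy : x ≠ y)
    (hx : x ∈ closure S) (hy : y ∈ closure S) {a b : Y}
    (ha : Filter.Tendsto f (nhdsWithin x S) (nhds a))
    (hb : Filter.Tendsto f (nhdsWithin y S) (nhds b)) : dist a b ≤ L * dist x y ^ α x := by
  have : (nhdsWithin x S).NeBot := mem_closure_iff_nhdsWithin_neBot.1 hx
  have : (nhdsWithin y S).NeBot := mem_closure_iff_nhdsWithin_neBot.1 hy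
  have hfst : Filter.Tendsto Prod.fst (nhdsWithin x S ×ˢ nhdsWithin y S) (nhds x) :=
    tendsto_nhds_of_tendsto_nhdsWithin Filter.tendsto_fst
  have hsnd : Filter.Tendsto Prod.snd (nhdsWithin x S ×ˢ nhdsWithin y S) (nhds y) :=
    tendsto_nhds_of_tendsto_nhdsWithin Filter.tendsto_snd
  refine le_of_tendsto_of_tendsto ((ha.comp Filter.tendsto_fst).dist (hb.comp Filter.tendsto_snd))
    (((hfst.dist hsnd).rpow ((hα.tendsto x).comp hfst)
      (Or.inl (dist_pos.2 hxy).ne')).const_mul L) ?_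
  filter_upwards [Filter.prod_mem_prod self_mem_nhdsWithin self_mem_nhdsWithin] with z hz
  exact hf z.1 hz.1 z.2 hz.2

theorem exists_holder_extension [CompleteSpace Y] {B : Set X} (hSB : B ⊆ closure S)
    (hα : Continuous α) (hκ : 0 < κ) (hκα : ∀ x, κ ≤ α x)
    (hf : ∀ x ∈ S, ∀ y ∈ S, dist (f x) (f y) ≤ L * dist x y ^ α x) :
    ∃ v : X → Y, ContinuousOn v B ∧ Set.EqOn v f S ∧
      ∀ x ∈ B, ∀ y ∈ B, dist (v x) (v y) ≤ L * dist x y ^ α x := by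
  have hcont := uniformContinuousOn_of_dist_le_mul_rpow hκ (fun x _ => hκα x) hf
  have hlim (x : X) (hx : x ∈ B) := 
    exists_tendsto_nhdsWithin_of_uniformContinuousOn hcont (hSB hx)
  refine ⟨extendFrom S f, continuousOn_extendFrom hSB hlim,
    extendFrom_extends hcont.continuousOn, fun x hx y hy => ?_⟩
  rcases eq_or_ne x y with rfl | hxy
  · rw [dist_self, dist_self, Real.zero_rpow (hκ.trans_le (hκα x)).ne', mul_zero]
  · exact dist_le_mul_rpow_of_tendsto hα hf hxy (hSB hx) (hSB hy) (tendsto_extendFrom (hlim x hx))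
      (tendsto_extendFrom (hlim y hy))

end HolderExtension

section Morrey

theorem integrable_and_dist_average_le {X E : Type*} [MeasurableSpace X] [NormedAddCommGroup E]
    [NormedSpace ℝ E] [CompleteSpace E] {ν : Measure X} [IsFiniteMeasure ν] [NeZero ν] {f : X → E}
    {S : Set X} {T : ℝ} (hf : AEStronglyMeasurable f ν) (hS : ∀ᵐ x ∂ν, x ∈ S)
    (hosc : ∀ x ∈ S, ∀ y ∈ S, dist (f x) (f y) ≤ T) :
    Integrable f ν ∧ ∀ x ∈ S, dist (f x) (⨍ y, f y ∂ν) ≤ T := by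
  have hball {x : X} (hx : x ∈ S) : ∀ᵐ y ∂ν, f y ∈ Metric.closedBall (f x) T :=
    hS.mono fun y hy => hosc y hy x hx
  obtain ⟨z, hz⟩ := hS.exists
  have hint : Integrable f ν := .of_bound hf (‖f z‖ + T) <|
    (hball hz).mono fun y hy => norm_le_norm_add_const_of_dist_le hy
  refine ⟨hint, fun x hx => ?_⟩
  rw [dist_comm]
  exact (convex_closedBall _ _).average_mem Metric.isClosed_closedBall (hball hx) hint

theorem subset_closure_of_ae_restrict_mem {X : Type*} [TopologicalSpace X] [MeasurableSpace X]
    [OpensMeasurableSpace X] {μ : Measure X} [μ.IsOpenPosMeasure] {B S : Set X} (hB : IsOpen B)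
    (hS : ∀ᵐ x ∂μ.restrict B, x ∈ S) : B ⊆ closure S := by
  refine ((Measure.dense_of_ae
    ((ae_restrict_iff' hB.measurableSet).1 hS)).open_subset_closure_inter hB).trans <|
    closure_mono fun x hx => hx.2 hx.1

/-- The Hölder constant of `u` for the exponent `holderExp`, per unit of `‖g‖`. -/
noncomputable def holderConst (b δ σ Λ : ℝ) : ℝ :=
  2 * holderChainConst Λ δ (gradientConst b δ Λ) (3 + 2 / (σ - 1))

/-- The constant `C_H` of the Morrey inequality. -/
noncomputable def morreyConst (b δ σ Λ : ℝ) : ℝ :=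
  holderConst b δ σ Λ * max 1 (radiusConst Λ δ 3)

theorem holderConst_pos {b δ σ Λ : ℝ} (hb : 0 < b) (hδ : 0 < δ) (hσ : 1 < σ) (hΛ : 0 < Λ) :
    0 < holderConst b δ σ Λ := by
  have : 0 < σ - 1 := sub_pos.2 hσ
  exact mul_pos two_pos (holderChainConst_pos hΛ (gradientConst_pos hb hδ) (by positivity))

theorem morreyConst_pos {b δ σ Λ : ℝ} (hb : 0 < b) (hδ : 0 < δ) (hσ : 1 < σ) (hΛ : 0 < Λ) :
    0 < morreyConst b δ σ Λ :=
  mul_pos (holderConst_pos hb hδ hσ hΛ) (zero_lt_one.trans_le (le_max_left _ _))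

theorem holderConst_le_mul_morreyConst_mul {b δ σ Λ a r₀ : ℝ} (hb : 0 < b) (hδ : 0 < δ)
    (hσ : 1 < σ) (hΛ : 0 < Λ) (hr₀ : 0 < r₀) (hr₀δ : σ * r₀ ≤ δ) (ha : 0 ≤ a) :
    holderConst b δ σ Λ ≤
      2 ^ (a + 1) * morreyConst b δ σ Λ * (σ * δ / ((σ - 1) * r₀)) ^ a := by
  have : 0 < σ - 1 := sub_pos.2 hσ
  have hM := morreyConst_pos (σ := σ) hb hδ hσ hΛ
  have htwo : (1 : ℝ) ≤ 2 ^ (a + 1) := Real.one_le_rpow one_le_two (by linarith)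
  have hratio : 1 ≤ (σ * δ / ((σ - 1) * r₀)) ^ a := by
    refine Real.one_le_rpow ((one_le_div (by positivity)).2 ?_) ha
    nlinarith
  calc holderConst b δ σ Λ ≤ morreyConst b δ σ Λ :=
        le_mul_of_one_le_right (holderConst_pos hb hδ hσ hΛ).le (le_max_left _ _)
    _ ≤ 2 ^ (a + 1) * morreyConst b δ σ Λ := le_mul_of_one_le_left hM.le htwo
    _ ≤ _ := le_mul_of_one_le_right (by positivity) hratio

theorem RegularExponents.dist_rpow_holderExp_le {X : Type*} [MetricSpace X] {Λ δ r₀ : ℝ}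
    {Q p ε : X → ℝ} {x₀ x y : X} (hexp : RegularExponents Λ Q p ε)
    (hα : 0 ≤ holderExp Q p ε x) (hr₀ : 0 < r₀) (hr₀δ : r₀ ≤ δ)
    (hx : x ∈ Metric.ball x₀ r₀) (hy : y ∈ Metric.ball x₀ r₀) :
    dist x y ^ holderExp Q p ε x ≤ radiusConst Λ δ 3 * r₀ ^ holderExp Q p ε x₀ := by
  refine le_trans ?_ (hexp.radius_rpow_le hexp.logHolder_holderExp (hexp.abs_holderExp_le x)
    (by norm_num) hr₀ hr₀δ hx)
  gcongr
  linarith [dist_triangle_right x y x₀, Metric.mem_ball.1 hx, Metric.mem_ball.1 hy]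

theorem RegularExponents.essSup_holderExp_nonneg {X : Type*} [MetricSpace X] [MeasurableSpace X]
    {μ : Measure X} [NeZero μ] {Λ : ℝ} {Q p ε : X → ℝ} (hexp : RegularExponents Λ Q p ε)
    (hα : ∀ x, 0 ≤ holderExp Q p ε x) : 0 ≤ essSup (holderExp Q p ε) μ := by
  have hbdd : Filter.IsBoundedUnder (· ≤ ·) (ae μ) (holderExp Q p ε) :=
    Filter.isBoundedUnder_of ⟨Λ ^ 2, fun x => (le_abs_self _).trans (hexp.abs_holderExp_le x)⟩
  obtain ⟨x, hx⟩ := (ae_le_essSup hbdd).exists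
  exact (hα x).trans hx

variable {X : Type*} [MetricSpace X] [MeasurableSpace X] [OpensMeasurableSpace X] {μ : Measure X}
  {b δ σ Λ r₀ a : ℝ} {Q p ε s : X → ℝ} {x₀ : X} {q : X → ℝ≥0∞} {u : X → EReal} {g : ℤ → X → ℝ≥0∞}

theorem LocalData.exists_holder_of_mixedNorm_lt (hset : Setting b δ Λ μ Q p ε s)
    (hα : ∀ x, (Λ ^ 2)⁻¹ ≤ holderExp Q p ε x) (hloc : LocalData δ σ μ p s x₀ r₀ q u g)
    (hb : 0 < b) (hσ : 1 < σ) (hΛ : 0 < Λ)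
    (ha : mixedNorm μ (Metric.ball x₀ (σ * r₀)) p q g < ENNReal.ofReal a) :
    ∃ S : Set X, (∀ᵐ x ∂μ.restrict (Metric.ball x₀ r₀), x ∈ S) ∧
      ∀ x ∈ S, ∀ y ∈ S, |(u x).toReal - (u y).toReal| ≤
        holderConst b δ σ Λ * a * dist x y ^ holderExp Q p ε x := by
  have hδ := hloc.delta_pos hσ
  have ha₀ : 0 < 2 * a := mul_pos two_pos (ENNReal.ofReal_pos.1 (bot_le.trans_lt ha))
  obtain ⟨S, H, hpair, hS, -⟩ := hloc.exists_hajlaszPair hset hb hσ hΛ ha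
  refine ⟨S ∩ Metric.ball x₀ r₀, ?_, fun x hx y hy => ?_⟩
  · filter_upwards [ae_mono (hloc.restrict_ball_le hσ) hS, ae_restrict_mem measurableSet_ball]
      with x hxS hxB using ⟨hxS, hxB⟩
  · have hxy := hpair.abs_sub_le_of_mem_ball (hset.regularExponents hΛ x₀)
      (one_le_gradientConst hb hδ) hσ (hloc.sub_one_mul_radius_le hσ) hα hx hy
    rw [← sub_div, abs_div, abs_of_pos ha₀, div_le_iff₀ ha₀] at hxy
    exact hxy.trans_eq (by rw [holderConst]; ring)

theorem LocalData.exists_holder_ae (hset : Setting b δ Λ μ Q p ε s)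
    (hα : ∀ x, (Λ ^ 2)⁻¹ ≤ holderExp Q p ε x) (hloc : LocalData δ σ μ p s x₀ r₀ q u g)
    (hb : 0 < b) (hσ : 1 < σ) (hΛ : 0 < Λ) :
    ∃ S ⊆ Metric.ball x₀ r₀, (∀ᵐ x ∂μ.restrict (Metric.ball x₀ r₀), x ∈ S) ∧
      ∀ x ∈ S, ∀ y ∈ S, |(u x).toReal - (u y).toReal| ≤
        holderConst b δ σ Λ * (mixedNorm μ (Metric.ball x₀ (σ * r₀)) p q g).toReal *
          dist x y ^ holderExp Q p ε x := by
  have hfin := hloc.g_mem.mixedNorm_lt_top hΛ (hset.regularExponents hΛ x₀).le_p hloc.q_mem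
  obtain ⟨a, -, ha, hlim⟩ :=
    exists_seq_strictAnti_tendsto (mixedNorm μ (Metric.ball x₀ (σ * r₀)) p q g).toReal
  choose S hS hholder using fun k => hloc.exists_holder_of_mixedNorm_lt hset hα hb hσ hΛ
    ((ENNReal.lt_ofReal_iff_toReal_lt hfin.ne).2 (ha k))
  refine ⟨Metric.ball x₀ r₀ ∩ ⋂ k, S k, Set.inter_subset_left, ?_, fun x hx y hy => ?_⟩
  · filter_upwards [ae_restrict_mem measurableSet_ball, ae_all_iff.2 hS] with x hxB hxS
      using ⟨hxB, Set.mem_iInter.2 hxS⟩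
  · exact ge_of_tendsto' ((hlim.const_mul _).mul_const _) fun k =>
      hholder k x (Set.mem_iInter.1 hx.2 k) y (Set.mem_iInter.1 hy.2 k)

theorem LocalData.integrableOn_and_essSup_absSub_avg_le (hset : Setting b δ Λ μ Q p ε s)
    (hα : ∀ x, (Λ ^ 2)⁻¹ ≤ holderExp Q p ε x) (hloc : LocalData δ σ μ p s x₀ r₀ q u g)
    (hb : 0 < b) (hσ : 1 < σ) (hΛ : 0 < Λ) :
    IntegrableOn (fun x => (u x).toReal) (Metric.ball x₀ r₀) μ ∧
    essSup (absSub u (avg μ (Metric.ball x₀ r₀) u)) (μ.restrict (Metric.ball x₀ r₀)) ≤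
      ENNReal.ofReal (morreyConst b δ σ Λ * r₀ ^ holderExp Q p ε x₀) *
        mixedNorm μ (Metric.ball x₀ (σ * r₀)) p q g := by
  have hδ := hloc.delta_pos hσ
  have hr₀ := hloc.radius_pos
  have hexp := hset.regularExponents hΛ x₀
  have hα₀ (x : X) : 0 ≤ holderExp Q p ε x := (inv_nonneg.2 (by positivity)).trans (hα x)
  have hC := holderConst_pos (σ := σ) hb hδ hσ hΛ
  have hM := morreyConst_pos (σ := σ) hb hδ hσ hΛ
  have hfin := hloc.g_mem.mixedNorm_lt_top hΛ hexp.le_p hloc.q_mem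
  have := hset.metricMeasure.isFiniteMeasure_restrict_ball hr₀ x₀
  have := hset.metricMeasure.restrict_ball_neZero hr₀ x₀
  obtain ⟨S, hSB, hS, hholder⟩ := hloc.exists_holder_ae hset hα hb hσ hΛ
  rw [← ENNReal.ofReal_toReal hfin.ne, ← ENNReal.ofReal_mul (by positivity)]
  set n := (mixedNorm μ (Metric.ball x₀ (σ * r₀)) p q g).toReal
  have hosc (x) (hx : x ∈ S) (y) (hy : y ∈ S) : |(u x).toReal - (u y).toReal| ≤
      morreyConst b δ σ Λ * r₀ ^ holderExp Q p ε x₀ * n := calc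
    _ ≤ holderConst b δ σ Λ * n * dist x y ^ holderExp Q p ε x := hholder x hx y hy
    _ ≤ holderConst b δ σ Λ * n * (max 1 (radiusConst Λ δ 3) * r₀ ^ holderExp Q p ε x₀) := by
      gcongr
      exact (hexp.dist_rpow_holderExp_le (hα₀ x) hr₀ (hloc.radius_le_delta hσ) (hSB hx)
        (hSB hy)).trans (by gcongr; exact le_max_right _ _)
    _ = _ := by
      rw [morreyConst]
      ring
  obtain ⟨hint, havg⟩ := integrable_and_dist_average_le
    (hloc.aemeasurable_toReal hσ).aestronglyMeasurable hS hosc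
  refine ⟨hint, essSup_le_of_ae_le _ ?_⟩
  filter_upwards [hS, hloc.ae_absSub_eq hσ (avg μ (Metric.ball x₀ r₀) u)] with x hx hux
  rw [hux]
  exact ENNReal.ofReal_le_ofReal (havg x hx)

theorem LocalData.exists_holder_representative (hset : Setting b δ Λ μ Q p ε s)
    (hα : ∀ x, (Λ ^ 2)⁻¹ ≤ holderExp Q p ε x) (hloc : LocalData δ σ μ p s x₀ r₀ q u g)
    (hb : 0 < b) (hσ : 1 < σ) (hΛ : 0 < Λ) :
    ∃ v : X → ℝ, ContinuousOn v (Metric.ball x₀ r₀) ∧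
      (∀ᵐ x ∂μ.restrict (Metric.ball x₀ r₀), u x = (v x : EReal)) ∧
      ∀ x ∈ Metric.ball x₀ r₀, ∀ y ∈ Metric.ball x₀ r₀, |v x - v y| ≤
        holderConst b δ σ Λ * (mixedNorm μ (Metric.ball x₀ (σ * r₀)) p q g).toReal *
          dist x y ^ holderExp Q p ε x := by
  have := hset.metricMeasure.isOpenPosMeasure
  obtain ⟨S, -, hS, hholder⟩ := hloc.exists_holder_ae hset hα hb hσ hΛ
  obtain ⟨v, hcont, hv, hvholder⟩ := exists_holder_extension (f := fun x => (u x).toReal)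
    (subset_closure_of_ae_restrict_mem Metric.isOpen_ball hS)
    (hset.regularExponents hΛ x₀).logHolder_holderExp.continuous (by positivity) hα hholder
  refine ⟨v, hcont, ?_, hvholder⟩
  filter_upwards [hS, ae_mono (hloc.restrict_ball_le hσ) hloc.u_mem.ae_finite] with x hx hux
  rw [hv hx, EReal.coe_toReal hux.1 hux.2]

theorem morrey_inequality (hset : Setting b δ Λ μ Q p ε s)
    (hgap : EssGap μ Λ⁻¹ Q (fun x => ε x * p x)) (hloc : LocalData δ σ μ p s x₀ r₀ q u g)
    (hb : 0 < b) (hσ : 1 < σ) (hΛ : 0 < Λ) :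
    IntegrableOn (fun x => (u x).toReal) (Metric.ball x₀ r₀) μ ∧
    essSup (absSub u (avg μ (Metric.ball x₀ r₀) u)) (μ.restrict (Metric.ball x₀ r₀)) ≤
      ENNReal.ofReal (morreyConst b δ σ Λ * r₀ ^ holderExp Q p ε x₀) *
        mixedNorm μ (Metric.ball x₀ (σ * r₀)) p q g ∧
    ∃ v : X → ℝ, ContinuousOn v (Metric.ball x₀ r₀) ∧
      (∀ᵐ x ∂μ.restrict (Metric.ball x₀ r₀), u x = (v x : EReal)) ∧
      ∀ x ∈ Metric.ball x₀ r₀, ∀ y ∈ Metric.ball x₀ r₀, |v x - v y| ≤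
        (2 : ℝ) ^ (essSup (holderExp Q p ε) μ + 1) * morreyConst b δ σ Λ *
          (σ * δ / ((σ - 1) * r₀)) ^ essSup (holderExp Q p ε) μ *
        (mixedNorm μ (Metric.ball x₀ (σ * r₀)) p q g).toReal *
        dist x y ^ holderExp Q p ε x := by
  have hexp := hset.regularExponents hΛ x₀
  have := hset.metricMeasure.isOpenPosMeasure
  have : Nonempty X := ⟨x₀⟩
  have hα (x : X) : (Λ ^ 2)⁻¹ ≤ holderExp Q p ε x := hexp.le_holderExp <|
    hgap.forall_le hset.metricMeasure hexp.continuous_Q (hexp.continuous_ε.mul hexp.continuous_p) x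
  have hsup : 0 ≤ essSup (holderExp Q p ε) μ :=
    hexp.essSup_holderExp_nonneg fun x => (inv_nonneg.2 (by positivity)).trans (hα x)
  obtain ⟨hint, hess⟩ := hloc.integrableOn_and_essSup_absSub_avg_le hset hα hb hσ hΛ
  obtain ⟨v, hcont, huv, hv⟩ := hloc.exists_holder_representative hset hα hb hσ hΛ
  refine ⟨hint, hess, v, hcont, huv, fun x hx y hy => (hv x hx y hy).trans ?_⟩
  gcongr
  exact holderConst_le_mul_morreyConst_mul hb (hloc.delta_pos hσ) hσ hΛ hloc.radius_pos
    (hloc.mul_radius_le hσ) hsup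

end Morrey

end HajlaszBesov

open HajlaszBesov in
theorem mainTheorem5 (b δ σ Λ : ℝ) (hb : 0 < b) (hb1 : b ≤ 1) (hδ : 0 < δ) (hσ : 1 < σ)
    (hΛ : 0 < Λ) :
    -- (i) the Sobolev case
    (∃ C_S : ℝ, 0 < C_S ∧
      ∀ (X : Type w) [MetricSpace X] [MeasurableSpace X] [BorelSpace X] (μ : Measure X)
        (Q p ε s : X → ℝ), Setting b δ Λ μ Q p ε s →
        EssGap μ Λ⁻¹ (fun x => ε x * p x) Q →
        ∀ (x₀ : X) (r₀ : ℝ) (q : X → ℝ≥0∞) (u : X → EReal) (g : ℤ → X → ℝ≥0∞),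
          LocalData δ σ μ p s x₀ r₀ q u g →
          ⨅ c : ℝ, luxNorm μ (Metric.ball x₀ r₀) (sobolevExp Q p ε) (absSub u c) ≤
            ENNReal.ofReal (C_S * (μ.real (Metric.ball x₀ r₀) / r₀ ^ Q x₀) ^
              (1 / essInf (sobolevExp Q p ε) (μ.restrict (Metric.ball x₀ r₀)))) *
            mixedNorm μ (Metric.ball x₀ (σ * r₀)) p q g) ∧
    -- (ii) the Moser-Trudinger case
    (∃ C_MT1 C_MT2 : ℝ, 0 < C_MT1 ∧ 0 < C_MT2 ∧
      ∀ (X : Type w) [MetricSpace X] [MeasurableSpace X] [BorelSpace X] (μ : Measure X)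
        (Q p ε s : X → ℝ), Setting b δ Λ μ Q p ε s →
        (∀ x, ε x * p x = Q x) →
        ∀ (x₀ : X) (r₀ : ℝ) (q : X → ℝ≥0∞) (u : X → EReal) (g : ℤ → X → ℝ≥0∞),
          LocalData δ σ μ p s x₀ r₀ q u g →
          0 < mixedNorm μ (Metric.ball x₀ (σ * r₀)) p q g →
          IntegrableOn (fun x => (u x).toReal) (Metric.ball x₀ r₀) μ ∧
          ⨍⁻ x in Metric.ball x₀ r₀, ENNReal.ofReal (Real.exp
            (C_MT1 * (|(u x).toReal - avg μ (Metric.ball x₀ r₀) u| /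
              (mixedNorm μ (Metric.ball x₀ (σ * r₀)) p q g).toReal))) ∂μ ≤
            ENNReal.ofReal C_MT2) ∧
    -- (iii) the Morrey case
    (∃ C_H : ℝ, 0 < C_H ∧
      ∀ (X : Type w) [MetricSpace X] [MeasurableSpace X] [BorelSpace X] (μ : Measure X)
        (Q p ε s : X → ℝ), Setting b δ Λ μ Q p ε s →
        EssGap μ Λ⁻¹ Q (fun x => ε x * p x) →
        ∀ (x₀ : X) (r₀ : ℝ) (q : X → ℝ≥0∞) (u : X → EReal) (g : ℤ → X → ℝ≥0∞),
          LocalData δ σ μ p s x₀ r₀ q u g →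
          IntegrableOn (fun x => (u x).toReal) (Metric.ball x₀ r₀) μ ∧
          essSup (absSub u (avg μ (Metric.ball x₀ r₀) u)) (μ.restrict (Metric.ball x₀ r₀)) ≤
            ENNReal.ofReal (C_H * r₀ ^ holderExp Q p ε x₀) *
              mixedNorm μ (Metric.ball x₀ (σ * r₀)) p q g ∧
          ∃ v : X → ℝ, ContinuousOn v (Metric.ball x₀ r₀) ∧
            (∀ᵐ x ∂μ.restrict (Metric.ball x₀ r₀), u x = (v x : EReal)) ∧
            ∀ x ∈ Metric.ball x₀ r₀, ∀ y ∈ Metric.ball x₀ r₀,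
              |v x - v y| ≤
                (2 : ℝ) ^ (essSup (holderExp Q p ε) μ + 1) * C_H *
                  (σ * δ / ((σ - 1) * r₀)) ^ essSup (holderExp Q p ε) μ *
                (mixedNorm μ (Metric.ball x₀ (σ * r₀)) p q g).toReal *
                dist x y ^ holderExp Q p ε x) :=
  ⟨⟨sobolevConst b δ σ Λ, sobolevConst_pos hb hδ hσ hΛ,
      fun _ _ _ _ _ _ _ _ _ hset hgap _ _ _ _ _ hloc =>
        sobolev_inequality hset hgap hloc hb hσ hΛ⟩,
    ⟨moserTrudingerRate b δ σ Λ, moserTrudingerConst b δ σ Λ ^ 2,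
      moserTrudingerRate_pos hb hδ hσ hΛ, pow_pos (moserTrudingerConst_pos hb hδ hσ) 2,
      fun _ _ _ _ _ _ _ _ _ hset hQε _ _ _ _ _ hloc hg =>
        moser_trudinger_inequality hset hQε hloc hb hσ hΛ hg⟩,
    ⟨morreyConst b δ σ Λ, morreyConst_pos hb hδ hσ hΛ,
      fun _ _ _ _ _ _ _ _ _ hset hgap _ _ _ _ _ hloc =>
        morrey_inequality hset hgap hloc hb hσ hΛ⟩⟩
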